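/- For $n \ge 0$ let $S_n^{\pm}$ denote the signed permutation (hyperoctahedral) group, i.e. the group of all permutations $\pi$ of the set $\{-n,\dots,-1,1,\dots,n\}$ such that $\pi(-x)=-\pi(x)$ for all $x$. For $n\ge 1$ regard $S_{n-1}^{\pm}$ as a subgroup of $S_n^{\pm}$ by extending a signed permutation of $\{\pm1,\dots,\pm(n-1)\}$ by the identity on $\pm n$. Then the signed permutation groups satisfy homological stability: for all integers $r\ge 0$ and $n>2r$, the inclusion-induced map on integral group homology (with trivial coefficients $\mathbb Z$) $$H_r(S_{n-1}^{\pm};\mathbb Z)\to H_r(S_n^{\pm};\mathbb Z)$$ is an isomorphism. -/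

import Mathlib

/-- The set `{-n, …, -1, 1, …, n}` of nonzero integers of absolute value at most `n`. -/
def SignedSet (n : ℕ) : Type := {x : ℤ // x ≠ 0 ∧ |x| ≤ (n : ℤ)}

namespace SignedSet

instance (n : ℕ) : Neg (SignedSet n) :=
  ⟨fun x => ⟨-x.1, neg_ne_zero.mpr x.2.1, by rw [abs_neg]; exact x.2.2⟩⟩

/-- The inclusion `{±1, …, ±m} ⊆ {±1, …, ±n}` for `m ≤ n`. -/
def incl {m n : ℕ} (h : m ≤ n) : SignedSet m ↪ SignedSet n where
  toFun x := ⟨x.1, x.2.1, x.2.2.trans (by exact_mod_cast h)⟩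
  inj' x y hxy := Subtype.ext (congrArg (fun z : SignedSet n => z.1) hxy)

theorem neg_neg' {n : ℕ} (x : SignedSet n) : - -x = x :=
  Subtype.ext (neg_neg x.1)

theorem incl_neg {m n : ℕ} (h : m ≤ n) (x : SignedSet m) : incl h (-x) = -incl h x := rfl

end SignedSet

/-- The signed permutation (hyperoctahedral) group: the permutations `π` of `{±1, …, ±n}` with
`π (-x) = -π x` for all `x`. -/
def SignedPerm (n : ℕ) : Subgroup (Equiv.Perm (SignedSet n)) where
  carrier := {π | ∀ x, π (-x) = -π x}
  mul_mem' {a b} ha hb x := by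
    change a (b (-x)) = -a (b x)
    rw [hb x, ha (b x)]
  one_mem' _ := rfl
  inv_mem' {a} ha x := by
    apply a.injective
    rw [ha (a⁻¹ x)]
    exact (a.apply_symm_apply (-x)).trans (congrArg _ (a.apply_symm_apply x).symm)

namespace SignedPerm

theorem viaEmbedding_mem {m n : ℕ} (h : m ≤ n) (π : SignedPerm m) :
    Equiv.Perm.viaEmbeddingHom (SignedSet.incl h) π.1 ∈ SignedPerm n := by
  intro x
  rw [Equiv.Perm.viaEmbeddingHom_apply]
  by_cases hx : x ∈ Set.range (SignedSet.incl h)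
  · obtain ⟨y, rfl⟩ := hx
    rw [← SignedSet.incl_neg, Equiv.Perm.viaEmbedding_apply, Equiv.Perm.viaEmbedding_apply,
      π.2 y, SignedSet.incl_neg]
  · have hx' : -x ∉ Set.range (SignedSet.incl h) := by
      rintro ⟨y, hy⟩
      exact hx ⟨-y, by rw [SignedSet.incl_neg, hy, SignedSet.neg_neg']⟩
    rw [Equiv.Perm.viaEmbedding_apply_of_notMem _ _ _ hx,
      Equiv.Perm.viaEmbedding_apply_of_notMem _ _ _ hx']

/-- The standard inclusion of signed permutation groups for `m ≤ n`: a signed permutation of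
`{±1, …, ±m}` is extended to `{±1, …, ±n}` by the identity. -/
noncomputable def incl {m n : ℕ} (h : m ≤ n) : SignedPerm m →* SignedPerm n :=
  ((Equiv.Perm.viaEmbeddingHom (SignedSet.incl h)).comp (SignedPerm m).subtype).codRestrict
    (SignedPerm n) (viaEmbedding_mem h)

end SignedPerm

/-- Integral group homology `H_r(G) = H_r(G; ℤ)`, with `ℤ` the trivial `G`-module. -/
noncomputable abbrev integralHomology (G : Type) [Group G] (r : ℕ) : ModuleCat ℤ :=
  groupHomology (Rep.trivial ℤ G ℤ) r

/-- The map `H_r(G; ℤ) ⟶ H_r(H; ℤ)` induced by a group homomorphism `f : G →* H` and the identity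
of the trivial module `ℤ`. -/
noncomputable abbrev integralHomologyMap {G H : Type} [Group G] [Group H] (f : G →* H) (r : ℕ) :
    integralHomology G r ⟶ integralHomology H r :=
  groupHomology.map (A := Rep.trivial ℤ G ℤ) (B := Rep.trivial ℤ H ℤ) f
    (CategoryTheory.CategoryStruct.id (Rep.trivial ℤ G ℤ)) r

/-! Let `G` be `SignedPerm n` and let `C k` be the free abelian group on words of length `k` in the
letters ±1, …, ±n with distinct absolute values. Deleting letters with alternating signs gives a
complex of `G`-modules, already augmented, since the empty word spans `C 0` = ℤ. Three facts drive
the proof.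

The complex is exact in degrees below `n` (`WordComplex.acyclic`): letters of one chosen index are
pushed to the left, modulo boundaries, until none remains, and the cycle is then coned off.

`G` acts transitively on words of length `k` with stabilizer `SignedPerm (n - k)`, so Shapiro's
lemma identifies H_q(G; `C k`) with H_q(`SignedPerm (n - k)`). All faces of the standard word induce
the same map, because they differ by elements commuting with the stabilizer and inner automorphisms
act trivially on homology. Hence `d n k` induces the stabilization map for `k` even and zero for `k`
odd (`SignedWord.shapiro_comp_d`).

Instead of a spectral sequence, the long exact sequences of 0 → Z (i+1) → C (i+1) → Z i → 0, with Z
the cycles, are combined by induction on the homological degree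
(`groupHomology.epi_map_toSeqCycles`, `groupHomology.isIso_map_d_zero`). Known stability in degrees
below `r` makes H_r(`d n 0`) surjective; its injectivity uses in addition that H_r(`d n 1`) = 0.

Shapiro's lemma and the triviality of inner automorphisms both come from dimension shifting along
`freeCover A`, whose higher homology vanishes because it is relatively projective. -/

section RelativeProjectivity

open CategoryTheory

universe u

section ContractNth

variable {G : Type*}

theorem Fin.contractNth_zero_cons {n : ℕ} (op : G → G → G) (a : G) (g : Fin (n + 1) → G) :
    Fin.contractNth 0 op (Fin.cons a g : Fin (n + 2) → G) =
      (Fin.cons (op a (g 0)) fun i : Fin n => g i.succ) := by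
  ext i
  refine Fin.cases ?_ (fun i => ?_) i
  · rw [Fin.contractNth_apply_of_eq _ _ _ _ (by simp)]
    simp
  · rw [Fin.contractNth_apply_of_gt _ _ _ _ (by simp)]
    simp

theorem Fin.contractNth_succ_cons {n : ℕ} (op : G → G → G) (j : Fin (n + 1)) (a : G)
    (g : Fin (n + 1) → G) :
    Fin.contractNth j.succ op (Fin.cons a g : Fin (n + 2) → G) =
      Fin.cons a (Fin.contractNth j op g) := by
  ext i
  refine Fin.cases ?_ (fun i => ?_) i
  · rw [Fin.contractNth_apply_of_lt _ _ _ _ (by simp)]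
    simp
  · rcases lt_trichotomy (i : ℕ) j with h | h | h
    · rw [Fin.contractNth_apply_of_lt _ _ _ _ (by simpa using h), Fin.cons_succ,
        Fin.contractNth_apply_of_lt _ _ _ _ h, ← Fin.succ_castSucc, Fin.cons_succ]
    · rw [Fin.contractNth_apply_of_eq _ _ _ _ (by simpa using h), Fin.cons_succ,
        Fin.cons_succ,
        Fin.contractNth_apply_of_eq _ _ _ _ h, ← Fin.succ_castSucc, Fin.cons_succ]
    · rw [Fin.contractNth_apply_of_gt _ _ _ _ (by simpa using h), Fin.cons_succ,
        Fin.cons_succ,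
        Fin.contractNth_apply_of_gt _ _ _ _ h]

end ContractNth

/-! ### Relatively projective representations and vanishing of their homology. -/

namespace Representation

variable {k G V : Type*} [CommRing k] [Group G] [Fintype G] [AddCommGroup V] [Module k V]

/-- A representation of a finite group is *relatively projective* if the identity is the average
`∑ g e g⁻¹` of the conjugates of some linear endomorphism `e`. -/
def IsRelativelyProjective (ρ : Representation k G V) : Prop :=
  ∃ e : V →ₗ[k] V, ∀ v, ∑ g : G, ρ g (e (ρ g⁻¹ v)) = v

/-- Relative projectivity is inherited by subgroups. -/
theorem IsRelativelyProjective.comp {ρ : Representation k G V} (h : ρ.IsRelativelyProjective)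
    {S : Type*} [Group S] [Fintype S] {f : S →* G} (hf : Function.Injective f) :
    IsRelativelyProjective (ρ.comp f : Representation k S V) := by
  classical
  obtain ⟨e, he⟩ := h
  -- Every element of `G` is uniquely `f s * t` with `t` in the transversal `T`; summing over `T`
  -- first gives the endomorphism for `S`.
  obtain ⟨T, hT, -⟩ := f.range.exists_isComplement_right 1
  have : Fintype T := Fintype.ofFinite T
  let E : S × T ≃ G :=
    (_root_.Equiv.prodCongr (f.ofInjective hf).toEquiv (_root_.Equiv.refl T)).trans
      (_root_.Equiv.ofBijective _ hT)
  have hE : ∀ s t, E (s, t) = f s * t := fun _ _ => rfl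
  refine ⟨∑ t : T, ρ (t : G) ∘ₗ e ∘ₗ ρ (t : G)⁻¹, fun v => ?_⟩
  conv_rhs => rw [← he v, ← Fintype.sum_equiv E (fun p => ρ (E p) (e (ρ (E p)⁻¹ v))) _ fun _ => rfl]
  rw [Fintype.sum_prod_type]
  refine Finset.sum_congr rfl fun s _ => ?_
  simp [hE, LinearMap.sum_apply]

end Representation

namespace groupHomology

open Representation Finsupp Limits

variable {k G : Type u} [CommRing k] [Group G]

/-- Averaging `e` gives a contracting homotopy `s` in positive degrees: the leading face of d ∘ s
sums to the identity by the choice of `e`, and all other terms cancel against s ∘ d. -/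
theorem chains_exact_of_isRelativelyProjective [Fintype G] (A : Rep.{u} k G)
    (h : A.ρ.IsRelativelyProjective) (n : ℕ) (z : (Fin (n + 1) → G) →₀ A)
    (hz : inhomogeneousChains.d A n z = 0) :
    ∃ y, inhomogeneousChains.d A (n + 1) y = z := by
  obtain ⟨e, he⟩ := h
  let s (m : ℕ) : ((Fin m → G) →₀ A) →ₗ[k] ((Fin (m + 1) → G) →₀ A) :=
    lsum (R := k) k fun g => ∑ x : G, lsingle (Fin.cons x⁻¹ g) ∘ₗ e ∘ₗ A.ρ x⁻¹
  have hs (m : ℕ) (g : Fin m → G) (a : A) :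
      s m (single g a) = ∑ x : G, single (Fin.cons x⁻¹ g) (e (A.ρ x⁻¹ a)) := by
    simp [s]
  have key : (inhomogeneousChains.d A (n + 1)).hom ∘ₗ s (n + 1) +
      s n ∘ₗ (inhomogeneousChains.d A n).hom = LinearMap.id := by
    refine lhom_ext fun g a => ?_
    simp only [LinearMap.add_apply, LinearMap.comp_apply, LinearMap.id_apply, hs,
      inhomogeneousChains.d_single (G := G), map_sum, map_add, map_smul]
    simp only [Finset.sum_add_distrib, Fin.sum_univ_succ (n := n + 1), Fin.cons_succ, Fin.cons_zero,
      Fin.contractNth_zero_cons, Fin.contractNth_succ_cons, inv_inv]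
    have h₁ : ∑ x : G, single (fun i => g i) (A.ρ x (e (A.ρ x⁻¹ a))) = single g a := by
      have := map_sum (lsingle (R := k) g) (fun x : G => A.ρ x (e (A.ρ x⁻¹ a))) Finset.univ
      rw [he] at this
      exact this.symm
    -- The leading face in s ∘ d matches the first contraction in d ∘ s under x ↦ g 0 * x.
    have h₂ : ∑ x : G, single (Fin.cons x⁻¹ fun i => g i.succ : Fin (n + 1) → G)
          (e (A.ρ x⁻¹ (A.ρ (g 0)⁻¹ a))) =
        ∑ x : G, single (Fin.cons (x⁻¹ * g 0) fun i => g i.succ : Fin (n + 1) → G)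
          (e (A.ρ x⁻¹ a)) := by
      refine Fintype.sum_equiv (_root_.Equiv.mulLeft (g 0)) _ _ fun x => ?_
      simp
    rw [h₁, h₂]
    simp only [Finset.smul_sum]
    rw [Finset.sum_comm (γ := G)]
    simp only [Fin.val_succ, pow_succ _ (_ + 1), mul_neg, mul_one, neg_smul,
      Finset.sum_neg_distrib, Fin.val_zero, zero_add, pow_one, one_smul]
    abel
  refine ⟨s (n + 1) z, ?_⟩
  have := LinearMap.congr_fun key z
  simpa [hz] using this

theorem isZero_of_isRelativelyProjective [Fintype G] (A : Rep.{u} k G)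
    (h : A.ρ.IsRelativelyProjective) (n : ℕ) : IsZero (groupHomology A (n + 1)) := by
  refine ((inhomogeneousChains A).exactAt_iff_isZero_homology _).1 ?_
  rw [HomologicalComplex.exactAt_iff' _ (n + 2) (n + 1) n (by simp) (by simp),
    ShortComplex.moduleCat_exact_iff]
  intro z hz
  obtain ⟨y, hy⟩ := chains_exact_of_isRelativelyProjective A h n z (by
    rw [← inhomogeneousChains.d_def]; exact hz)
  refine ⟨y, ?_⟩
  rw [← hy, ← inhomogeneousChains.d_def]
  rfl

end groupHomology

namespace Rep

open Finsupp Representation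

variable {k G : Type u} [CommRing k] [Group G]

theorem exact_iff (S : ShortComplex (Rep.{u} k G)) :
    S.Exact ↔ Function.Exact S.f.hom S.g.hom := by
  rw [← ShortComplex.exact_map_iff_of_faithful S (forget₂ (Rep.{u} k G) (ModuleCat.{u} k)),
    ShortComplex.ShortExact.moduleCat_exact_iff_function_exact]
  rfl

theorem shortExact_iff (S : ShortComplex (Rep.{u} k G)) :
    S.ShortExact ↔ Function.Injective S.f.hom ∧ Function.Surjective S.g.hom ∧
      Function.Exact S.f.hom S.g.hom := by
  rw [← mono_iff_injective, ← epi_iff_surjective, ← exact_iff]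
  exact ⟨fun h => ⟨h.2, h.3, h.1⟩, fun h => @ShortComplex.ShortExact.mk _ _ _ _ h.2.2 h.1 h.2.1⟩

/-- The representation `X →₀ A` with `G` acting diagonally on the `G`-set `X` and on `A`. -/
noncomputable abbrev permTensor (X : Type u) [MulAction G X] (A : Rep.{u} k G) : Rep.{u} k G :=
  Rep.of (X := X →₀ A)
    { toFun g := mapRange.linearMap (A.ρ g) ∘ₗ lmapDomain A k (g • ·)
      map_one' := by ext; simp
      map_mul' g h := by ext; simp [mul_smul] }

theorem permTensor_ρ_single {X : Type u} [MulAction G X] (A : Rep.{u} k G) (g : G) (x : X) (a : A) :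
    (permTensor X A).ρ g (single x a) = single (g • x) (A.ρ g a) := by
  simp

/-- The morphism `X →₀ A ⟶ X →₀ B` induced by a morphism `A ⟶ B`. -/
noncomputable abbrev permTensorMap (X : Type u) [MulAction G X] {A B : Rep.{u} k G} (φ : A ⟶ B) :
    permTensor X A ⟶ permTensor X B :=
  Rep.ofHom ⟨mapRange.linearMap φ.hom.toLinearMap, fun g => by
    ext; simp [hom_comm_apply]⟩

end Rep

end RelativeProjectivity

/-! ### Dimension shifting and Shapiro's lemma for transitive `G`-sets. -/

section TransitiveShapiro

open CategoryTheory

universe u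

namespace Rep

open Finsupp Representation Limits

variable {k G : Type u} [CommRing k] [Group G]

/-- The representation `G →₀ A` with `G` acting by left translation only. -/
noncomputable abbrev freeCover (A : Rep.{u} k G) : Rep.{u} k G :=
  Rep.of (X := G →₀ A)
    { toFun g := lmapDomain A k (g * ·)
      map_one' := by ext; simp
      map_mul' g h := by ext; simp [mul_assoc] }

/-- The morphism `G →₀ A ⟶ A` sending `single g a` to `g • a`. -/
noncomputable abbrev freeCoverπ (A : Rep.{u} k G) : freeCover A ⟶ A :=
  Rep.ofHom ⟨lsum (R := k) k fun g => A.ρ g, fun g => by ext; simp⟩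

instance (A : Rep.{u} k G) : Epi (freeCoverπ A) :=
  (epi_iff_surjective _).2 fun a => ⟨single 1 a, by simp⟩

theorem isRelativelyProjective_freeCover [Fintype G] (A : Rep.{u} k G) :
    (freeCover A).ρ.IsRelativelyProjective := by
  classical
  -- The conjugate by `g` of the projection to the coordinate 1 is the projection to the coordinate
  -- `g`.
  refine ⟨lsingle 1 ∘ₗ lapply 1, fun v => ?_⟩
  induction v using Finsupp.induction_linear with
  | zero => simp
  | add v w hv hw =>
    conv_rhs => rw [← hv, ← hw, ← Finset.sum_add_distrib]
    simp only [map_add]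
  | single h a =>
    rw [Finset.sum_eq_single h]
    · simp
    · intro g _ hg
      simp [inv_mul_eq_one, hg]
    · simp

theorem isRelativelyProjective_permTensor [Fintype G] {A : Rep.{u} k G}
    (h : A.ρ.IsRelativelyProjective) (X : Type u) [MulAction G X] :
    (permTensor X A).ρ.IsRelativelyProjective := by
  obtain ⟨e, he⟩ := h
  refine ⟨mapRange.linearMap e, fun v => ?_⟩
  induction v using Finsupp.induction_linear with
  | zero => simp
  | add v w hv hw =>
    conv_rhs => rw [← hv, ← hw, ← Finset.sum_add_distrib]
    simp only [map_add]
  | single x a =>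
    have := map_sum (lsingle (R := k) x) (fun g : G => A.ρ g (e (A.ρ g⁻¹ a))) Finset.univ
    rw [he] at this
    simpa using this.symm

/-- The short complex `ker ⟶ (G →₀ A) ⟶ A`. -/
noncomputable abbrev freeCoverShortComplex (A : Rep.{u} k G) : ShortComplex (Rep.{u} k G) :=
  ShortComplex.mk (kernel.ι (freeCoverπ A)) (freeCoverπ A) (kernel.condition _)

theorem shortExact_freeCoverShortComplex (A : Rep.{u} k G) :
    (freeCoverShortComplex A).ShortExact where
  exact := ShortComplex.exact_of_f_is_kernel _ (kernelIsKernel _)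
  mono_f := inferInstance
  epi_g := inferInstance

/-- Tensoring a short complex with the permutation representation of `X`. -/
noncomputable abbrev permTensorShortComplex (X : Type u) [MulAction G X]
    (S : ShortComplex (Rep.{u} k G)) : ShortComplex (Rep.{u} k G) :=
  ShortComplex.mk (permTensorMap X S.f) (permTensorMap X S.g) (by
    ext : 2
    refine lhom_ext fun x a => ?_
    have h : S.g.hom (S.f.hom a) = 0 := congrArg (fun φ : S.X₁ ⟶ S.X₃ => φ.hom a) S.zero
    simp [h])

theorem shortExact_permTensorShortComplex (X : Type u) [MulAction G X]
    {S : ShortComplex (Rep.{u} k G)} (hS : S.ShortExact) :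
    (permTensorShortComplex X S).ShortExact := by
  rw [shortExact_iff] at hS ⊢
  obtain ⟨h₁, h₂, h₃⟩ := hS
  refine ⟨mapRange_injective _ (map_zero _) h₁, mapRange_surjective _ (map_zero _) h₂, ?_⟩
  have h₄ : LinearMap.ker S.g.hom.toLinearMap = LinearMap.range S.f.hom.toLinearMap :=
    LinearMap.exact_iff.1 h₃
  change Function.Exact (mapRange.linearMap S.f.hom.toLinearMap)
    (mapRange.linearMap S.g.hom.toLinearMap)
  rw [LinearMap.exact_iff, ker_mapRange, range_mapRange_linearMap _ (LinearMap.ker_eq_bot.2 h₁), h₄]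

end Rep

namespace groupHomology

open Rep Finsupp Limits

variable {k G S : Type u} [CommRing k] [Group G] [Group S]

theorem chainsMap_comm {A A' : Rep.{u} k S} {B B' : Rep.{u} k G} {f : S →* G}
    {φ : A ⟶ res f B} {φ' : A' ⟶ res f B'} {a : A ⟶ A'} {b : B ⟶ B'}
    (h : ∀ x, b.hom (φ.hom x) = φ'.hom (a.hom x)) :
    chainsMap f φ ≫ chainsMap (MonoidHom.id G) b =
      chainsMap (MonoidHom.id S) a ≫ chainsMap f φ' := by
  rw [← chainsMap_comp, ← chainsMap_comp (MonoidHom.id S) f a φ']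
  exact chainsMap_congr rfl (LinearMap.ext h)

theorem map_comm {A A' : Rep.{u} k S} {B B' : Rep.{u} k G} {f : S →* G}
    {φ : A ⟶ res f B} {φ' : A' ⟶ res f B'} {a : A ⟶ A'} {b : B ⟶ B'}
    (h : ∀ x, b.hom (φ.hom x) = φ'.hom (a.hom x)) (n : ℕ) :
    map f φ n ≫ map (MonoidHom.id G) b n = map (MonoidHom.id S) a n ≫ map f φ' n := by
  have := congrArg (HomologicalComplex.homologyMap · n) (chainsMap_comm h)
  rwa [HomologicalComplex.homologyMap_comp, HomologicalComplex.homologyMap_comp] at this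

section Ladder

variable {X : ShortComplex (Rep.{u} k S)} {Y : ShortComplex (Rep.{u} k G)}
  {f : S →* G} {φ₁ : X.X₁ ⟶ res f Y.X₁} {φ₂ : X.X₂ ⟶ res f Y.X₂} {φ₃ : X.X₃ ⟶ res f Y.X₃}

theorem δ_naturality (hX : X.ShortExact) (hY : Y.ShortExact)
    (h₁₂ : ∀ x, Y.f.hom (φ₁.hom x) = φ₂.hom (X.f.hom x))
    (h₂₃ : ∀ x, Y.g.hom (φ₂.hom x) = φ₃.hom (X.g.hom x)) (n : ℕ) :
    δ hX (n + 1) n rfl ≫ map f φ₁ n = map f φ₃ (n + 1) ≫ δ hY (n + 1) n rfl :=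
  HomologicalComplex.HomologySequence.δ_naturality
    (S₁ := X.map (chainsFunctor k S)) (S₂ := Y.map (chainsFunctor k G))
    { τ₁ := chainsMap f φ₁
      τ₂ := chainsMap f φ₂
      τ₃ := chainsMap f φ₃
      comm₁₂ := chainsMap_comm h₁₂
      comm₂₃ := chainsMap_comm h₂₃ }
    (map_chainsFunctor_shortExact hX) (map_chainsFunctor_shortExact hY) (n + 1) n rfl

/-- The step of dimension shifting: with vanishing middle terms, each H_{n+1} of the quotient is the
kernel of H_n of the subobject → H_n of the middle, so isomorphisms on the latter two induce one on
kernels. -/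
theorem isIso_map_succ_of_isZero (hX : X.ShortExact) (hY : Y.ShortExact)
    (h₁₂ : ∀ x, Y.f.hom (φ₁.hom x) = φ₂.hom (X.f.hom x))
    (h₂₃ : ∀ x, Y.g.hom (φ₂.hom x) = φ₃.hom (X.g.hom x)) (n : ℕ)
    (hX₂ : IsZero (groupHomology X.X₂ (n + 1))) (hY₂ : IsZero (groupHomology Y.X₂ (n + 1)))
    (i₁ : IsIso (map f φ₁ n)) (i₂ : IsIso (map f φ₂ n)) :
    IsIso (map f φ₃ (n + 1)) := by
  have := mono_δ_of_isZero hX n hX₂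
  have := mono_δ_of_isZero hY n hY₂
  have hnat := δ_naturality hX hY h₁₂ h₂₃ n
  have hm : Mono (map f φ₃ (n + 1)) := by
    have : Mono (map f φ₃ (n + 1) ≫ δ hY (n + 1) n rfl) := by
      rw [← hnat]; infer_instance
    exact mono_of_mono _ (δ hY (n + 1) n rfl)
  have hzero : (δ hY (n + 1) n rfl ≫ inv (map f φ₁ n)) ≫ map (MonoidHom.id S) X.f n = 0 := by
    rw [← cancel_mono (map f φ₂ n), Category.assoc, Category.assoc, ← map_comm h₁₂,
      IsIso.inv_hom_id_assoc, zero_comp]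
    exact (mapShortComplex₁ hY rfl).zero
  have : Mono (mapShortComplex₁ hX (i := n + 1) rfl).f := ‹Mono (δ hX (n + 1) n rfl)›
  have he : IsSplitEpi (map f φ₃ (n + 1)) := by
    obtain ⟨l, hl⟩ : ∃ l : groupHomology Y.X₃ (n + 1) ⟶ groupHomology X.X₃ (n + 1),
        l ≫ δ hX (n + 1) n rfl = δ hY (n + 1) n rfl ≫ inv (map f φ₁ n) :=
      ⟨(mapShortComplex₁_exact hX (i := n + 1) rfl).lift _ hzero,
        (mapShortComplex₁_exact hX (i := n + 1) rfl).lift_f _ hzero⟩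
    refine ⟨⟨l, ?_⟩⟩
    rw [← cancel_mono (δ hY (n + 1) n rfl), Category.assoc, ← hnat, reassoc_of% hl]
    simp
  exact isIso_of_mono_of_epi _

end Ladder

theorem H0π_ρ_apply (A : Rep.{u} k G) (g : G) (a : A) : H0π A (A.ρ g a) = H0π A a := by
  rw [← coinvariantsMk_comp_H0Iso_inv]
  exact congrArg (H0Iso A).inv (Representation.Coinvariants.mk_self_apply A.ρ g a)

/-- A linear map out of `H₀` from an invariant linear map. -/
noncomputable def H0Desc (A : Rep.{u} k G) {M : ModuleCat.{u} k} (l : A.V →ₗ[k] M)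
    (hl : ∀ g, l ∘ₗ A.ρ g = l) : groupHomology A 0 ⟶ M :=
  (H0Iso A).hom ≫ ModuleCat.ofHom (Representation.Coinvariants.lift A.ρ l hl)

theorem H0π_comp_H0Desc (A : Rep.{u} k G) {M : ModuleCat.{u} k} (l : A.V →ₗ[k] M)
    (hl : ∀ g, l ∘ₗ A.ρ g = l) : H0π A ≫ H0Desc A l hl = ModuleCat.ofHom l := by
  rw [H0Desc, H0π_comp_H0Iso_hom_assoc]
  rfl

/-- Inner automorphisms act trivially on group homology. -/
theorem map_conj_eq_id [Fintype G] (g : G) (n : ℕ) (A : Rep.{u} k G)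
    (φ : A ⟶ res (MulAut.conj g).toMonoidHom A) (hφ : ∀ a, φ.hom a = A.ρ g a) :
    map (MulAut.conj g).toMonoidHom φ n = 𝟙 _ := by
  induction n generalizing A with
  | zero =>
    rw [← cancel_epi (H0π A), H0π_comp_map]
    ext a
    change H0π A (φ.hom a) = H0π A a
    rw [hφ, H0π_ρ_apply]
  | succ n ih =>
    let ψ (B : Rep.{u} k G) : B ⟶ res (MulAut.conj g).toMonoidHom B :=
      Rep.ofHom ⟨B.ρ g, fun h => by ext; simp⟩
    -- The connecting map of this sequence is injective and commutes with the action of `g`, which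
    -- reduces the claim to the kernel one degree lower.
    let hX := shortExact_freeCoverShortComplex A
    have := mono_δ_of_isZero hX n
      (isZero_of_isRelativelyProjective _ (isRelativelyProjective_freeCover A) n)
    rw [← cancel_mono (δ hX (n + 1) n rfl)]
    have h := δ_naturality (φ₁ := ψ _) (φ₂ := ψ _) (φ₃ := φ) hX hX
      (fun x => hom_comm_apply _ _ _) (fun x => by rw [hφ]; exact hom_comm_apply _ _ _) n
    rw [ih _ (ψ _) fun _ => rfl] at h
    simpa using h.symm

section Shapiro

variable {X : Type u} [MulAction G X] (f : S →* G) (w : X)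

/-- The morphism `A ⟶ X →₀ A` sending `a` to `single w a`, where `w` is fixed by `S`. -/
noncomputable abbrev permTensorSingle (hw : ∀ s, f s • w = w) (A : Rep.{u} k G) :
    res f A ⟶ res f (permTensor X A) :=
  Rep.ofHom ⟨lsingle w, fun s => by ext; simp [hw]⟩

/-- The inverse on coinvariants sends `single x a` to the class of `(t x)⁻¹ • a`, where `t x`
carries `w` to `x`. It is invariant because `(t (g • x))⁻¹ * g * t x` fixes `w`, hence comes from
`S`. -/
theorem isIso_map_permTensorSingle_zero (hw : ∀ s, f s • w = w)
    (hrange : ∀ g : G, g • w = w → g ∈ f.range) (htrans : ∀ x : X, ∃ g : G, g • w = x)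
    (A : Rep.{u} k G) : IsIso (map f (permTensorSingle f w hw A) 0) := by
  choose t ht using htrans
  have ht' (x : X) : (t x)⁻¹ • x = w := by rw [inv_smul_eq_iff, ht]
  have hS (g : G) (hg : g • w = w) (a : A) : H0π (res f A) (A.ρ g a) = H0π (res f A) a := by
    obtain ⟨s, rfl⟩ := hrange g hg
    exact H0π_ρ_apply (res f A) s a
  let l : (permTensor X A).V →ₗ[k] groupHomology (res f A) 0 :=
    lsum (R := k) k fun x => (H0π (res f A)).hom ∘ₗ A.ρ (t x)⁻¹
  have hl_single (x : X) (a : A) : l (single x a) = H0π (res f A) (A.ρ (t x)⁻¹ a) := by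
    simp [l]
  have hl : ∀ g, l ∘ₗ (permTensor X A).ρ g = l := fun g => lhom_ext fun x a => by
    rw [LinearMap.comp_apply, permTensor_ρ_single, hl_single, hl_single,
      ← hS ((t (g • x))⁻¹ * g * t x) (by rw [mul_smul, mul_smul, ht, ht']) (A.ρ (t x)⁻¹ a)]
    simp
  refine ⟨H0Desc _ l hl, ?_, ?_⟩
  · rw [← cancel_epi (H0π (res f A)), H0π_comp_map_assoc, H0π_comp_H0Desc]
    ext a
    change l (single w a) = H0π (res f A) a
    rw [hl_single, hS _ (ht' w)]
  · rw [← cancel_epi (H0π (permTensor X A)), ← Category.assoc, H0π_comp_H0Desc]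
    refine ModuleCat.hom_ext (lhom_ext fun x a => ?_)
    change map f (permTensorSingle f w hw A) 0 (l (single x a)) = H0π (permTensor X A) (single x a)
    rw [hl_single]
    have := ConcreteCategory.congr_hom (H0π_comp_map f (permTensorSingle f w hw A)) (A.ρ (t x)⁻¹ a)
    refine this.trans ?_
    change H0π (permTensor X A) (single w (A.ρ (t x)⁻¹ a)) = _
    rw [← H0π_ρ_apply _ (t x), permTensor_ρ_single, ht]
    simp

/-- Shapiro's lemma for a transitive `G`-set `X` and a group `S` mapping isomorphically to the
stabilizer of a point `w`. -/
theorem isIso_map_permTensorSingle [Fintype G] [Fintype S] (hf : Function.Injective f)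
    (hw : ∀ s, f s • w = w) (hrange : ∀ g : G, g • w = w → g ∈ f.range)
    (htrans : ∀ x : X, ∃ g : G, g • w = x) (n : ℕ) (A : Rep.{u} k G) :
    IsIso (map f (permTensorSingle f w hw A) n) := by
  induction n generalizing A with
  | zero => exact isIso_map_permTensorSingle_zero f w hw hrange htrans A
  | succ n ih =>
    have hA := shortExact_freeCoverShortComplex A
    have hP := isRelativelyProjective_freeCover A
    have hc {B C : Rep.{u} k G} (φ : B ⟶ C) (b : B) :
        (permTensorMap X φ).hom ((permTensorSingle f w hw B).hom b) =
          (permTensorSingle f w hw C).hom (((resFunctor f).map φ).hom b) :=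
      (mapRange_single (f := φ.hom) (hf := map_zero _))
    have hX₂ := isZero_of_isRelativelyProjective (res f (freeCover A)) (hP.comp hf) n
    have hY₂ := isZero_of_isRelativelyProjective _ (isRelativelyProjective_permTensor hP X) n
    exact isIso_map_succ_of_isZero
      (X := (freeCoverShortComplex A).map (resFunctor f))
      (Y := permTensorShortComplex X (freeCoverShortComplex A))
      (φ₁ := permTensorSingle f w hw _) (φ₂ := permTensorSingle f w hw _)
      (φ₃ := permTensorSingle f w hw _)
      ((shortExact_res f).2 hA) (shortExact_permTensorShortComplex X hA)
      (hc (freeCoverShortComplex A).f) (hc (freeCoverShortComplex A).g) n hX₂ hY₂ (ih _) (ih _)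

end Shapiro

end groupHomology

end TransitiveShapiro

/-! ### Homology of cycles in a partially exact complex, by long exact sequences. -/

section CycleSequence

open CategoryTheory

universe u

namespace Rep

open Limits

variable {k G : Type u} [CommRing k] [Group G]
  {C : ℕ → Rep.{u} k G} (d : ∀ i, C (i + 1) ⟶ C i)

/-- The cycles of a sequence of morphisms `⋯ ⟶ C 1 ⟶ C 0 ⟶ 0`. -/
noncomputable def seqCycles : ℕ → Rep.{u} k G
  | 0 => C 0
  | i + 1 => kernel (d i)

/-- The inclusion of the cycles. -/
noncomputable def seqCyclesι : ∀ i, seqCycles d i ⟶ C i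
  | 0 => 𝟙 (C 0)
  | i + 1 => kernel.ι (d i)

instance : ∀ i, Mono (seqCyclesι d i)
  | 0 => inferInstanceAs (Mono (𝟙 (C 0)))
  | i + 1 => inferInstanceAs (Mono (kernel.ι (d i)))

variable (hd : ∀ i, d (i + 1) ≫ d i = 0)

/-- The differential as a morphism to the cycles. -/
noncomputable def toSeqCycles : ∀ i, C (i + 1) ⟶ seqCycles d i
  | 0 => d 0
  | i + 1 => kernel.lift (d i) (d (i + 1)) (hd i)

theorem toSeqCycles_comp_ι : ∀ i, toSeqCycles d hd i ≫ seqCyclesι d i = d i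
  | 0 => Category.comp_id (d 0)
  | i + 1 => kernel.lift_ι (d i) (d (i + 1)) (hd i)

/-- The short complex `Z (i + 1) ⟶ C (i + 1) ⟶ Z i`. -/
noncomputable abbrev seqShortComplex (i : ℕ) : ShortComplex (Rep.{u} k G) :=
  ShortComplex.mk (seqCyclesι d (i + 1)) (toSeqCycles d hd i) (by
    rw [← cancel_mono (seqCyclesι d i), Category.assoc, toSeqCycles_comp_ι, zero_comp]
    exact kernel.condition (d i))

theorem shortExact_seqShortComplex (i : ℕ) (he : Epi (toSeqCycles d hd i)) :
    (seqShortComplex d hd i).ShortExact where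
  exact := by
    refine ShortComplex.exact_of_f_is_kernel _ ?_
    refine KernelFork.IsLimit.ofι' _ _ fun {A} x hx => ⟨kernel.lift (d i) x ?_, kernel.lift_ι _ _ _⟩
    rw [← toSeqCycles_comp_ι d hd i, reassoc_of% hx, zero_comp]
  mono_f := inferInstanceAs (Mono (seqCyclesι d (i + 1)))
  epi_g := he

end Rep

namespace groupHomology

open Rep Limits

variable {k G : Type u} [CommRing k] [Group G]
  {C : ℕ → Rep.{u} k G} (d : ∀ i, C (i + 1) ⟶ C i) (hd : ∀ i, d (i + 1) ≫ d i = 0)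

theorem map_toSeqCycles_comp_map_ι (i q : ℕ) :
    (functor k G q).map (toSeqCycles d hd i) ≫ (functor k G q).map (seqCyclesι d i) =
      (functor k G q).map (d i) := by
  rw [← Functor.map_comp, toSeqCycles_comp_ι]

theorem map_ι_comp_map_toSeqCycles (i q : ℕ) :
    (functor k G q).map (seqCyclesι d (i + 1)) ≫
      (functor k G q).map (toSeqCycles d hd i) = 0 := by
  exact ((seqShortComplex d hd i).map (functor k G q)).zero

/-- The connecting map H_{q+1}(Z i) → H_q(Z (i+1)) lands in the kernel of the map to H_q(C (i+1)),
so it vanishes. -/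
theorem epi_map_toSeqCycles_succ {i q : ℕ} (he : Epi (toSeqCycles d hd i))
    (hm : Mono ((functor k G q).map (seqCyclesι d (i + 1)))) :
    Epi ((functor k G (q + 1)).map (toSeqCycles d hd i)) := by
  have hS := shortExact_seqShortComplex d hd i he
  have h₁ : δ hS (q + 1) q rfl = 0 :=
    hm.right_cancellation _ _ ((mapShortComplex₁ hS (i := q + 1) rfl).zero.trans zero_comp.symm)
  exact (mapShortComplex₃_exact hS (i := q + 1) rfl).epi_f h₁

theorem mono_map_seqCyclesι_of_mono {i q : ℕ}
    (he : Epi ((functor k G q).map (toSeqCycles d hd i)))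
    (hm : Mono ((functor k G q).map (d i))) :
    Mono ((functor k G q).map (seqCyclesι d i)) := by
  rw [← map_toSeqCycles_comp_map_ι d hd] at hm
  have := mono_of_mono ((functor k G q).map (toSeqCycles d hd i))
    ((functor k G q).map (seqCyclesι d i))
  have := isIso_of_mono_of_epi ((functor k G q).map (toSeqCycles d hd i))
  rw [← IsIso.inv_hom_id_assoc ((functor k G q).map (toSeqCycles d hd i))
    ((functor k G q).map (seqCyclesι d i))]
  infer_instance

/-- In fact H_q(Z i) = 0: the map onto it from H_q(C (i+1)) is killed by precomposition with the
epimorphism H_q(`d (i + 1)`). -/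
theorem mono_map_seqCyclesι_of_epi {i q : ℕ}
    (he : Epi ((functor k G q).map (toSeqCycles d hd i)))
    (he' : Epi ((functor k G q).map (d (i + 1)))) :
    Mono ((functor k G q).map (seqCyclesι d i)) := by
  have h₀ : (functor k G q).map (toSeqCycles d hd i) = 0 := by
    rw [← cancel_epi ((functor k G q).map (d (i + 1))), ← map_toSeqCycles_comp_map_ι d hd,
      Category.assoc, map_ι_comp_map_toSeqCycles, comp_zero, comp_zero]
  have hz : IsZero ((functor k G q).obj (seqCycles d i)) := by
    rw [IsZero.iff_id_eq_zero, ← cancel_epi ((functor k G q).map (toSeqCycles d hd i)), h₀,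
      zero_comp, zero_comp]
  exact ⟨fun _ _ _ => hz.eq_of_tgt _ _⟩

/-- If the differentials induce isomorphisms on homology from odd to even position in the range
`i + 2 * q < n`, then the homology of the cycles is a quotient of that of the chains. -/
theorem epi_map_toSeqCycles {n Q : ℕ} (he : ∀ i < n, Epi (toSeqCycles d hd i))
    (hiso : ∀ i q, q < Q → Even i → i + 2 * q < n → IsIso ((functor k G q).map (d i)))
    (q : ℕ) (hq : q ≤ Q) (i : ℕ) (hi : i < n) (hiq : i + 2 * q ≤ n) (hiq' : Even i → i + 2 * q < n) :
    Epi ((functor k G q).map (toSeqCycles d hd i)) := by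
  induction q generalizing i with
  | zero =>
    have := he i hi
    exact epi_map_0_of_epi (toSeqCycles d hd i)
  | succ q ih =>
    refine epi_map_toSeqCycles_succ d hd (he i hi) ?_
    -- It remains to see that H_q(Z (i+1)) → H_q(C (i+1)) is injective. For `i` even the source
    -- vanishes by surjectivity of H_q(`d (i + 2)`); for `i` odd the isomorphism H_q(`d (i + 1)`)
    -- factors through the map.
    rcases Nat.even_or_odd i with h | h
    · have := hiq' h
      have h1 := ih (by omega) (i + 1) (by omega) (by omega) (by grind)
      have := hiso (i + 2) q (by omega) (by grind) (by omega)
      exact mono_map_seqCyclesι_of_epi d hd h1 inferInstance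
    · have h1 := ih (by omega) (i + 1) (by omega) (by omega) (by grind)
      have := hiso (i + 1) q (by omega) (by grind) (by omega)
      exact mono_map_seqCyclesι_of_mono d hd h1 inferInstance

theorem isIso_map_d_zero {n r : ℕ} (he : ∀ i < n, Epi (toSeqCycles d hd i))
    (hiso : ∀ i q, q < r → Even i → i + 2 * q < n → IsIso ((functor k G q).map (d i)))
    (hn : 2 ≤ n) (hr : 2 * r < n) (hzero : (functor k G r).map (d 1) = 0) :
    IsIso ((functor k G r).map (d 0)) := by
  have hepi : Epi ((functor k G r).map (d 0)) :=
    epi_map_toSeqCycles d hd he hiso r le_rfl 0 (by omega) (by omega) (by omega)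
  have hepi₁ := epi_map_toSeqCycles d hd he hiso r le_rfl 1 (by omega) (by omega) (by simp)
  -- H_r(C 2) surjects onto H_r(Z 1), so the vanishing of H_r(`d 1`) passes to the inclusion of Z 1;
  -- exactness at H_r(C 1) then gives injectivity.
  have h0 : (functor k G r).map (seqCyclesι d 1) = 0 := by
    rw [← cancel_epi ((functor k G r).map (toSeqCycles d hd 1)), map_toSeqCycles_comp_map_ι,
      hzero, comp_zero]
  have hmono : Mono ((functor k G r).map (d 0)) :=
    (mapShortComplex₂_exact (shortExact_seqShortComplex d hd 0 (he 0 (by omega))) r).mono_g h0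
  exact isIso_of_mono_of_epi _

end groupHomology

end CycleSequence

/-! ### Acyclicity of the complex of words with distinct indices. -/

section WordAcyclicity

open Finsupp

namespace WordComplex

variable {E : Type*}

/-- Prefixing words by a fixed word, extended linearly. -/
noncomputable def pre (u : List E) : (List E →₀ ℤ) →ₗ[ℤ] (List E →₀ ℤ) :=
  lmapDomain ℤ ℤ (u ++ ·)

@[simp]
theorem pre_single (u v : List E) (c : ℤ) : pre u (single v c) = single (u ++ v) c := by
  simp [pre]

theorem pre_apply (u v : List E) (m : List E →₀ ℤ) : pre u m (u ++ v) = m v :=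
  mapDomain_apply (List.append_right_injective u) m v

theorem pre_apply_eq_zero {u l : List E} (h : ¬ u <+: l) (m : List E →₀ ℤ) :
    pre u m l = 0 :=
  mapDomain_of_notMem_range _ _ (by rintro ⟨v, rfl⟩; exact h (List.prefix_append u v))

theorem pre_cons (x : E) (u : List E) (m : List E →₀ ℤ) : pre (x :: u) m = pre [x] (pre u m) := by
  induction m using Finsupp.induction_linear with
  | zero => simp
  | add _ _ h₁ h₂ => simp [h₁, h₂]
  | single => simp

theorem pre_mem_supported {u : List E} {m : List E →₀ ℤ} {V V' : Set (List E)}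
    (hm : m ∈ supported ℤ ℤ V) (h : ∀ v ∈ V, u ++ v ∈ V') : pre u m ∈ supported ℤ ℤ V' := by
  classical
  rw [mem_supported] at hm ⊢
  intro l hl
  obtain ⟨v, hv, rfl⟩ := Finset.mem_image.1 (mapDomain_support hl)
  exact h v (hm hv)

/-- The coefficients of the words with a given prefix. -/
noncomputable def strip (u : List E) : (List E →₀ ℤ) →ₗ[ℤ] (List E →₀ ℤ) :=
  lcomapDomain (u ++ ·) (List.append_right_injective u)

@[simp]
theorem strip_apply (u v : List E) (m : List E →₀ ℤ) : strip u m v = m (u ++ v) := rfl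

theorem strip_cons (x : E) (u : List E) (m : List E →₀ ℤ) :
    strip (x :: u) m = strip u (strip [x] m) := by
  ext; simp

theorem strip_pre_self (x : E) (m : List E →₀ ℤ) : strip [x] (pre [x] m) = m := by
  ext v
  exact pre_apply [x] v m

theorem strip_pre_of_ne {x y : E} (h : x ≠ y) (m : List E →₀ ℤ) : strip [x] (pre [y] m) = 0 := by
  ext v
  exact pre_apply_eq_zero (by simpa using h.symm) m

theorem strip_single_eq_zero {u l : List E} (h : ¬ u <+: l) (c : ℤ) :
    strip u (single l c) = 0 := by
  ext v
  rw [strip_apply, single_eq_of_ne]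
  · rfl
  · rintro rfl
    exact h (List.prefix_append u v)

/-- The boundary of a word: the alternating sum of the words obtained by deleting one letter. -/
noncomputable def bd : List E → (List E →₀ ℤ)
  | [] => 0
  | x :: l => single l 1 - pre [x] (bd l)

/-- The boundary operator on linear combinations of words. -/
noncomputable def boundary : (List E →₀ ℤ) →ₗ[ℤ] (List E →₀ ℤ) :=
  Finsupp.lift _ ℤ _ bd

@[simp]
theorem boundary_single (l : List E) (c : ℤ) : boundary (single l c) = c • bd l := by
  simp [boundary]

theorem boundary_pre_singleton (x : E) (m : List E →₀ ℤ) :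
    boundary (pre [x] m) = m - pre [x] (boundary m) := by
  induction m using Finsupp.induction_linear with
  | zero => simp
  | add _ _ h₁ h₂ => simp only [map_add, h₁, h₂]; abel
  | single => simp [bd, smul_sub]

theorem boundary_bd (l : List E) : boundary (bd l) = 0 := by
  induction l with
  | nil => simp [bd]
  | cons x l ih => simp [bd, boundary_pre_singleton, ih]

theorem boundary_boundary (m : List E →₀ ℤ) : boundary (boundary m) = 0 := by
  induction m using Finsupp.induction_linear with
  | zero => simp
  | add _ _ h₁ h₂ => simp only [map_add, h₁, h₂, add_zero]
  | single => simp [boundary_bd]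

theorem bd_mem_supported (l : List E) :
    bd l ∈ supported ℤ ℤ {l' : List E | l'.Sublist l ∧ l'.length + 1 = l.length} := by
  induction l with
  | nil => simp [bd]
  | cons x l ih =>
    refine sub_mem (single_mem_supported _ _ ⟨List.sublist_cons_self x l, rfl⟩)
      (pre_mem_supported ih fun v hv => ?_)
    exact ⟨hv.1.cons_cons x, by simpa using hv.2⟩

theorem boundary_mem_supported {V V' : Set (List E)} {m : List E →₀ ℤ} (hm : m ∈ supported ℤ ℤ V)
    (h : ∀ l ∈ V, ∀ l' : List E, l'.Sublist l → l'.length + 1 = l.length → l' ∈ V') :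
    boundary m ∈ supported ℤ ℤ V' := by
  rw [supported_eq_span_single] at hm
  induction hm using Submodule.span_induction with
  | mem x hx =>
    obtain ⟨l, hl, rfl⟩ := hx
    rw [boundary_single, one_smul]
    exact supported_mono (fun l' hl' => h l hl l' hl'.1 hl'.2) (bd_mem_supported l)
  | zero => simp
  | add _ _ _ _ h₁ h₂ => rw [map_add]; exact add_mem h₁ h₂
  | smul c _ _ h => rw [map_smul]; exact Submodule.smul_mem _ c h

/-- Leibniz rule: the error consists of terms in which a letter of the prefix was deleted, leaving
only `j` letters before the word from `V`. -/
theorem boundary_pre_sub_mem_supported {V : Set (List E)} {m : List E →₀ ℤ}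
    (hm : m ∈ supported ℤ ℤ V) {j : ℕ} {u : List E} (hu : u.length = j + 1) :
    boundary (pre u m) - (-1 : ℤ) ^ (j + 1) • pre u (boundary m) ∈
      supported ℤ ℤ {l : List E | l.drop j ∈ V} := by
  induction j generalizing u with
  | zero =>
    obtain ⟨x, rfl⟩ := List.length_eq_one_iff.1 hu
    simpa [boundary_pre_singleton] using hm
  | succ j ih =>
    obtain ⟨x, u, rfl⟩ := List.exists_cons_of_length_eq_add_one hu
    have hu' : u.length = j + 1 := by simpa using hu
    have h : boundary (pre (x :: u) m) - (-1 : ℤ) ^ (j + 1 + 1) • pre (x :: u) (boundary m) =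
        pre u m - pre [x] (boundary (pre u m) - (-1 : ℤ) ^ (j + 1) • pre u (boundary m)) := by
      rw [pre_cons x u m, pre_cons x u (boundary m), boundary_pre_singleton, map_sub,
        map_smul, pow_succ]
      simp only [mul_neg, mul_one, neg_smul]
      abel
    rw [h]
    refine sub_mem (pre_mem_supported hm fun v hv => ?_) (pre_mem_supported (ih hu') fun v hv => ?_)
    · simpa [← hu'] using hv
    · simpa using hv

variable {ι : Type*} (p : E → ι)

/-- Deleting a letter at or before the position of `e` pulls a letter of index other than `a` into
that position, so only deletions behind the prefix contribute; the sign counts the letters skipped.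
-/
theorem strip_bd {a : ι} {e : E} (he : p e = a) (u l : List E)
    (hl : ∀ x ∈ l.drop (u.length + 1), p x ≠ a) :
    strip (u ++ [e]) (bd l) =
      (-1 : ℤ) ^ (u.length + 1) • boundary (strip (u ++ [e]) (single l 1)) := by
  classical
  induction u generalizing l with
  | nil =>
    cases l with
    | nil => simp [bd, strip_single_eq_zero]
    | cons x l =>
      have h₁ : strip [e] (single l (1 : ℤ)) = 0 := by
        refine strip_single_eq_zero ?_ 1
        rintro ⟨v, rfl⟩
        exact hl e (by simp) he
      rw [List.nil_append, bd, map_sub, h₁]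
      by_cases hx : e = x
      · subst hx
        have h₂ : single (e :: l) (1 : ℤ) = pre [e] (single l 1) := by simp
        rw [h₂, strip_pre_self, strip_pre_self]
        simp
      · rw [strip_pre_of_ne hx, strip_single_eq_zero (by simpa using hx)]
        simp
  | cons b u ih =>
    cases l with
    | nil => simp [bd, strip_single_eq_zero]
    | cons x l =>
      have h₁ : strip (b :: u ++ [e]) (single l (1 : ℤ)) = 0 := by
        refine strip_single_eq_zero ?_ 1
        rintro ⟨v, rfl⟩
        exact hl e (by simp) he
      rw [bd, map_sub, h₁]
      by_cases hx : b = x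
      · subst hx
        have h₂ : single (b :: l) (1 : ℤ) = pre [b] (single l 1) := by simp
        rw [h₂, List.cons_append, strip_cons b (u ++ [e]) (pre [b] (bd l)),
          strip_cons b (u ++ [e]) (pre [b] (single l 1)), strip_pre_self, strip_pre_self,
          ih l (by simpa using hl)]
        simp [pow_succ]
      · rw [strip_single_eq_zero (by simp [hx]), List.cons_append, strip_cons,
          strip_pre_of_ne hx]
        simp

theorem boundary_strip_eq_zero {a : ι} {e : E} (he : p e = a) (u : List E) {z : List E →₀ ℤ}
    (hz : z ∈ supported ℤ ℤ {l : List E | ∀ x ∈ l.drop (u.length + 1), p x ≠ a})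
    (hbz : boundary z = 0) : boundary (strip (u ++ [e]) z) = 0 := by
  have key : strip (u ++ [e]) (boundary z) =
      (-1 : ℤ) ^ (u.length + 1) • boundary (strip (u ++ [e]) z) := by
    rw [supported_eq_span_single] at hz
    clear hbz
    induction hz using Submodule.span_induction with
    | mem x hx =>
      obtain ⟨l, hl, rfl⟩ := hx
      simpa using strip_bd p he u l hl
    | zero => simp
    | add _ _ _ _ h₁ h₂ => simp only [map_add, h₁, h₂, smul_add]
    | smul c _ _ h => simp only [map_smul, h, smul_comm c]
  rw [hbz, map_zero] at key
  rcases neg_one_pow_eq_or ℤ (u.length + 1) with h | h <;> rw [h] at key <;> simpa using key.symm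

/-- Words of length `k` whose letters have distinct indices in `s`. -/
def words (s : Finset ι) (k : ℕ) : Set (List E) :=
  {l | l.length = k ∧ (l.map p).Nodup ∧ ∀ x ∈ l, p x ∈ s}

theorem boundary_mem_words {s : Finset ι} {k : ℕ} {m : List E →₀ ℤ}
    (hm : m ∈ supported ℤ ℤ (words p s (k + 1))) : boundary m ∈ supported ℤ ℤ (words p s k) :=
  boundary_mem_supported hm fun l hl l' h hlen =>
    ⟨by have := hl.1; omega, hl.2.1.sublist (h.map p), fun x hx => hl.2.2 x (h.subset hx)⟩

/-- Every cycle in the complex of words over `s` of length less than `#s` is a boundary. -/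
def Acyclic (s : Finset ι) : Prop :=
  ∀ k < s.card, ∀ z ∈ supported ℤ ℤ (words p s k), boundary z = 0 →
    ∃ y ∈ supported ℤ ℤ (words p s (k + 1)), boundary y = z

variable {p} in
theorem exists_take_eq_append {a : ι} {j : ℕ} {l : List E} (h₁ : ∀ x ∈ l.drop (j + 1), p x ≠ a)
    (h₂ : ¬ ∀ x ∈ l.drop j, p x ≠ a) :
    ∃ u e, l.take (j + 1) = u ++ [e] ∧ u.length = j ∧ p e = a := by
  have hj : j < l.length := by
    by_contra! h
    exact h₂ (by simp [List.drop_eq_nil_of_le h])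
  refine ⟨l.take j, l[j], (List.take_append_getElem hj).symm, by simp; omega, ?_⟩
  by_contra h
  refine h₂ fun x hx => ?_
  rw [List.drop_eq_getElem_cons hj, List.mem_cons] at hx
  rcases hx with rfl | hx
  · exact h
  · exact h₁ x hx

/-- A cycle in which the letters of index `a` occur among the first `j + 1` positions is
homologous to one in which they occur among the first `j` positions. -/
theorem exists_sub_boundary_mem {s : Finset ι} {a : ι}
    (ih : ∀ t ⊂ s, Acyclic p t) {k j : ℕ} (hk : k < s.card) {z : List E →₀ ℤ}
    (hz : z ∈ supported ℤ ℤ (words p s k))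
    (hzj : z ∈ supported ℤ ℤ {l : List E | ∀ x ∈ l.drop (j + 1), p x ≠ a})
    (hbz : boundary z = 0) :
    ∃ y ∈ supported ℤ ℤ (words p s (k + 1)),
      z - boundary y ∈ supported ℤ ℤ {l : List E | ∀ x ∈ l.drop j, p x ≠ a} := by
  classical
  rw [mem_supported] at hz hzj
  -- The prefixes, ending in a letter of index `a`, of the words of `z` that still violate the
  -- target condition.
  let T : Finset (List E) :=
    (z.support.filter fun l => ¬ ∀ x ∈ l.drop j, p x ≠ a).image (List.take (j + 1))
  have hT : ∀ P ∈ T, (∃ u e, P = u ++ [e] ∧ u.length = j ∧ p e = a) ∧ P.length = j + 1 ∧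
      (P.map p).Nodup ∧ (∀ x ∈ P, p x ∈ s) ∧ j + 1 ≤ k := by
    intro P hP
    obtain ⟨l, hl, rfl⟩ := Finset.mem_image.1 hP
    obtain ⟨hl, hlj⟩ := Finset.mem_filter.1 hl
    obtain ⟨hlen, hnd, hs⟩ := hz hl
    obtain ⟨u, e, hue, hu, he⟩ := exists_take_eq_append (hzj hl) hlj
    have hlen' : (l.take (j + 1)).length = j + 1 := by rw [hue]; simp [hu]
    refine ⟨⟨u, e, hue, hu, he⟩, hlen', hnd.sublist ((List.take_sublist _ _).map p),
      fun x hx => hs x (List.mem_of_mem_take hx), ?_⟩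
    rw [List.length_take] at hlen'
    omega
  -- The part of `z` behind `P` is a cycle over the indices unused by `P`; length and number of
  -- indices both drop by `j + 1`, so induction applies.
  have hY : ∀ P ∈ T, ∃ y ∈ supported ℤ ℤ (words p (s \ (P.map p).toFinset) (k - j)),
      boundary y = strip P z := by
    intro P hP
    obtain ⟨⟨u, e, hue, hu, he⟩, hlen, hnd, hs, hjk⟩ := hT P hP
    have hsub : (P.map p).toFinset ⊆ s := by
      intro i hi
      obtain ⟨x, hx, rfl⟩ := List.mem_map.1 (List.mem_toFinset.1 hi)
      exact hs x hx
    have hcard : (s \ (P.map p).toFinset).card = s.card - (j + 1) := by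
      rw [Finset.card_sdiff_of_subset hsub, List.toFinset_card_of_nodup hnd, List.length_map, hlen]
    have hss : s \ (P.map p).toFinset ⊂ s := by
      refine Finset.ssubset_iff_subset_ne.2 ⟨Finset.sdiff_subset, fun h => ?_⟩
      rw [h] at hcard
      omega
    have := ih _ hss (k - (j + 1)) (by omega) (strip P z) ?_ ?_
    · rwa [show k - (j + 1) + 1 = k - j by omega] at this
    · rw [mem_supported]
      intro v hv
      have hv' : P ++ v ∈ z.support := by simpa using hv
      obtain ⟨h₁, h₂, h₃⟩ := hz hv'
      rw [List.map_append, List.nodup_append] at h₂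
      refine ⟨by rw [List.length_append] at h₁; omega, h₂.2.1, fun x hx => ?_⟩
      refine Finset.mem_sdiff.2 ⟨h₃ x (by simp [hx]), fun hx' => ?_⟩
      exact h₂.2.2 _ (List.mem_toFinset.1 hx') _ (List.mem_map_of_mem hx) rfl
    · rw [hue]
      refine boundary_strip_eq_zero p he u ?_ hbz
      rw [hu]
      exact (mem_supported _ _).2 hzj
  choose! Y hYmem hYbd using hY
  refine ⟨∑ P ∈ T, (-1 : ℤ) ^ (j + 1) • pre P (Y P), ?_, ?_⟩
  · refine sum_mem fun P hP => Submodule.smul_mem _ _ (pre_mem_supported (hYmem P hP) ?_)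
    rintro v ⟨h₁, h₂, h₃⟩
    obtain ⟨-, hlen, hnd, hs, hjk⟩ := hT P hP
    refine ⟨by rw [List.length_append]; omega, ?_, ?_⟩
    · rw [List.map_append, List.nodup_append]
      refine ⟨hnd, h₂, ?_⟩
      rintro _ hx _ hy rfl
      obtain ⟨x', hx', rfl⟩ := List.mem_map.1 hy
      exact (Finset.mem_sdiff.1 (h₃ x' hx')).2 (List.mem_toFinset.2 hx)
    · intro x hx
      rcases List.mem_append.1 hx with hx | hx
      · exact hs x hx
      · exact (Finset.mem_sdiff.1 (h₃ x hx)).1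
  -- The first difference removes the offending words; the Leibniz errors have only `j` letters
  -- before a word from `Y P`, which avoids the index `a`.
  · have hsplit : z - boundary (∑ P ∈ T, (-1 : ℤ) ^ (j + 1) • pre P (Y P)) =
        (z - ∑ P ∈ T, pre P (strip P z)) - ∑ P ∈ T, (-1 : ℤ) ^ (j + 1) •
          (boundary (pre P (Y P)) - (-1 : ℤ) ^ (j + 1) • pre P (boundary (Y P))) := by
      have h₁ : ∑ P ∈ T, pre P (strip P z) = ∑ P ∈ T, pre P (boundary (Y P)) :=
        Finset.sum_congr rfl fun P hP => by rw [hYbd P hP]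
      have h₂ : (-1 : ℤ) ^ (j + 1) * (-1) ^ (j + 1) = 1 := by
        rw [← mul_pow]; simp
      simp only [smul_sub, smul_smul, h₂, one_smul, Finset.sum_sub_distrib, h₁, map_sum, map_smul]
      abel
    rw [hsplit]
    refine sub_mem ?_ (sum_mem fun P hP => Submodule.smul_mem _ _ ?_)
    · rw [mem_supported']
      intro l hl
      by_cases hPT : l.take (j + 1) ∈ T
      · have hlen := (hT _ hPT).2.1
        rw [Finsupp.sub_apply, Finsupp.finsetSum_apply, Finset.sum_eq_single (l.take (j + 1))]
        · have h := pre_apply (l.take (j + 1)) (l.drop (j + 1)) (strip (l.take (j + 1)) z)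
          rw [strip_apply, List.take_append_drop] at h
          rw [h, sub_self]
        · intro P hP hne
          refine pre_apply_eq_zero (fun h => hne ?_) _
          rw [List.prefix_iff_eq_take.1 h, (hT P hP).2.1]
        · exact fun h => absurd hPT h
      · have hz0 : z l = 0 := by
          by_contra h
          exact hPT (Finset.mem_image_of_mem _ (Finset.mem_filter.2 ⟨mem_support_iff.2 h, hl⟩))
        rw [Finsupp.sub_apply, Finsupp.finsetSum_apply, hz0, Finset.sum_eq_zero, sub_zero]
        intro P hP
        refine pre_apply_eq_zero (fun h => hPT ?_) _
        rw [← (hT P hP).2.1, ← List.prefix_iff_eq_take.1 h]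
        exact hP
    · refine supported_mono ?_ (boundary_pre_sub_mem_supported (hYmem P hP) (hT P hP).2.1)
      intro l hl x hx hxa
      obtain ⟨⟨u, e, hue, hu, he⟩, -⟩ := hT P hP
      refine (Finset.mem_sdiff.1 (hl.2.2 x hx)).2 (List.mem_toFinset.2 ?_)
      rw [hue, hxa, ← he]
      simp

theorem acyclic (hp : Function.Surjective p) (s : Finset ι) : Acyclic p s := by
  classical
  induction s using Finset.strongInduction with
  | H s ih =>
    intro k hk z hz hbz
    obtain ⟨a, ha⟩ := Finset.card_pos.1 (by omega : 0 < s.card)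
    -- At `j = 0` the condition is empty, since the words have length `k`; at `j = k` no letter of
    -- index `a` is left.
    have hpos : ∀ j, ∃ y ∈ supported ℤ ℤ (words p s (k + 1)),
        z - boundary y ∈ supported ℤ ℤ {l : List E | ∀ x ∈ l.drop (k - j), p x ≠ a} := by
      intro j
      induction j with
      | zero =>
        refine ⟨0, zero_mem _, ?_⟩
        rw [map_zero, sub_zero]
        refine supported_mono (fun l hl x hx => ?_) hz
        rw [Nat.sub_zero, List.drop_eq_nil_of_le hl.1.le] at hx
        simp at hx
      | succ j ihj =>
        obtain ⟨y, hy, hyj⟩ := ihj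
        rcases Nat.lt_or_ge j k with hjk | hjk
        · rw [show k - j = k - (j + 1) + 1 by omega] at hyj
          obtain ⟨y', hy', hyj'⟩ := exists_sub_boundary_mem p ih hk
            (sub_mem hz (boundary_mem_words p hy)) hyj
            (by rw [map_sub, hbz, boundary_boundary, sub_zero])
          refine ⟨y + y', add_mem hy hy', ?_⟩
          rwa [map_add, ← sub_sub]
        · refine ⟨y, hy, ?_⟩
          rwa [show k - (j + 1) = k - j by omega]
    obtain ⟨y, hy, hyj⟩ := hpos k
    obtain ⟨e, he⟩ := hp a
    have hz' : z - boundary y ∈ supported ℤ ℤ (words p s k) := sub_mem hz (boundary_mem_words p hy)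
    -- The remaining cycle avoids the index `a`, so prefixing `e` is allowed and cones it off.
    refine ⟨y + pre [e] (z - boundary y), add_mem hy ?_, ?_⟩
    · have : z - boundary y ∈ supported ℤ ℤ (words p s k ∩ {l | ∀ x ∈ l, p x ≠ a}) := by
        rw [supported_inter]
        exact ⟨hz', by simpa using hyj⟩
      refine pre_mem_supported this ?_
      rintro v ⟨⟨h₁, h₂, h₃⟩, h₄⟩
      refine ⟨by simp [h₁], ?_, ?_⟩
      · simp only [List.singleton_append, List.map_cons, List.nodup_cons, List.mem_map, not_exists,
          not_and]
        exact ⟨fun x hx hxe => h₄ x hx (hxe.trans he), h₂⟩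
      · simp only [List.singleton_append, List.mem_cons, forall_eq_or_imp]
        exact ⟨he ▸ ha, h₃⟩
    · rw [map_add, boundary_pre_singleton, map_sub, hbz, boundary_boundary]
      simp

end WordComplex

end WordAcyclicity

/-! ### Signed words, their stabilizers and their faces. -/

section SignedWords

namespace SignedSet

variable {n : ℕ}

@[simp]
theorem neg_val (x : SignedSet n) : (-x).1 = -x.1 := rfl

theorem abs_le_natCast_iff {z : ℤ} {m : ℕ} : |z| ≤ (m : ℤ) ↔ z.natAbs ≤ m := by
  rw [Int.abs_eq_natAbs, Nat.cast_le]

theorem natAbs_le (x : SignedSet n) : x.1.natAbs ≤ n := abs_le_natCast_iff.1 x.2.2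

theorem neg_ne_self (x : SignedSet n) : -x ≠ x := fun h => by
  have h₁ := congrArg Subtype.val h
  have h₂ := x.2.1
  simp only [neg_val] at h₁
  omega

instance : Finite (SignedSet n) :=
  Finite.of_injective (β := Set.Icc (-(n : ℤ)) n) (fun x => ⟨x.1, abs_le.1 x.2.2⟩)
    fun _ _ h => Subtype.ext (Subtype.mk.inj h)

/-- The index `|x| - 1` of a signed letter. -/
def idx (x : SignedSet n) : Fin n :=
  ⟨x.1.natAbs - 1, by have := x.2.1; have := x.natAbs_le; omega⟩

theorem idx_eq_idx_iff {x y : SignedSet n} : idx x = idx y ↔ x = y ∨ x = -y := by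
  have hx := x.2.1
  have hy := y.2.1
  rw [idx, idx, Fin.mk.injEq]
  constructor
  · intro h
    rcases (by omega : x.1 = y.1 ∨ x.1 = -y.1) with h | h
    · exact Or.inl (Subtype.ext h)
    · exact Or.inr (Subtype.ext h)
  · rintro (rfl | rfl)
    · rfl
    · simp

/-- The letter `n - i`. -/
def letter {i : ℕ} (h : i < n) : SignedSet n :=
  ⟨n - i, by omega, abs_le_natCast_iff.2 (by omega)⟩

theorem eq_letter_or (x : SignedSet n) (i : ℕ) (hi : i + x.1.natAbs = n) :
    ∃ h : i < n, x = letter h ∨ x = -letter h := by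
  have hx := x.2.1
  refine ⟨by omega, ?_⟩
  rcases (by omega : x.1 = n - i ∨ x.1 = -(n - i)) with h | h
  · exact Or.inl (Subtype.ext h)
  · exact Or.inr (Subtype.ext h)

theorem idx_letter_injective {i j : ℕ} {hi : i < n} {hj : j < n}
    (h : idx (letter hi) = idx (letter hj)) : i = j := by
  have := congrArg Fin.val h
  simp only [idx, letter] at this
  omega

theorem idx_surjective : Function.Surjective (idx (n := n)) := fun i =>
  ⟨letter (i := n - 1 - i) (by omega), by
    ext
    simp only [idx, letter]
    omega⟩

theorem mem_range_incl {m : ℕ} (h : m ≤ n) {x : SignedSet n} :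
    x ∈ Set.range (incl h) ↔ x.1.natAbs ≤ m := by
  constructor
  · rintro ⟨y, rfl⟩
    exact y.natAbs_le
  · intro hx
    exact ⟨⟨x.1, x.2.1, abs_le_natCast_iff.2 hx⟩, rfl⟩

end SignedSet

namespace SignedPerm

open SignedSet

variable {n : ℕ}

theorem apply_neg (g : SignedPerm n) (x : SignedSet n) : g.1 (-x) = -g.1 x := g.2 x

theorem idx_apply_eq_iff (g : SignedPerm n) {x y : SignedSet n} :
    idx (g.1 x) = idx (g.1 y) ↔ idx x = idx y := by
  rw [idx_eq_idx_iff, idx_eq_idx_iff, ← apply_neg, g.1.injective.eq_iff, g.1.injective.eq_iff]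

theorem ext_apply {g h : SignedPerm n} (H : ∀ x, g.1 x = h.1 x) : g = h :=
  Subtype.ext (Equiv.ext H)

section Swap

open Classical in
/-- The signed transposition exchanging `a` with `b` and `-a` with `-b`, as a function. -/
noncomputable def swapFun (a b x : SignedSet n) : SignedSet n :=
  if x = a then b else if x = b then a else if x = -a then -b else if x = -b then -a else x

theorem swapFun_swapFun (a b x : SignedSet n) : swapFun a b (swapFun a b x) = x := by
  have h₁ := neg_ne_self a
  have h₂ := neg_ne_self b
  have h₃ := neg_neg' a
  have h₄ := neg_neg' b
  unfold swapFun
  grind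

theorem swapFun_neg (a b x : SignedSet n) : swapFun a b (-x) = -swapFun a b x := by
  have h₁ := neg_ne_self a
  have h₂ := neg_ne_self b
  have h₃ := neg_neg' a
  have h₄ := neg_neg' b
  have h₅ := neg_neg' x
  unfold swapFun
  grind

/-- The signed transposition exchanging `a` with `b` and `-a` with `-b`. -/
noncomputable def swap (a b : SignedSet n) : SignedPerm n :=
  ⟨⟨swapFun a b, swapFun a b, swapFun_swapFun a b, swapFun_swapFun a b⟩, swapFun_neg a b⟩

theorem swap_apply_left (a b : SignedSet n) : (swap a b).1 a = b := by
  change swapFun a b a = b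
  simp [swapFun]

theorem swap_apply_of_idx_ne {a b x : SignedSet n} (ha : idx x ≠ idx a) (hb : idx x ≠ idx b) :
    (swap a b).1 x = x := by
  rw [Ne, idx_eq_idx_iff, not_or] at ha hb
  change swapFun a b x = x
  simp [swapFun, ha, hb]

end Swap

/-- The signed permutation group acts transitively on words of given length whose letters have
distinct absolute values. -/
theorem exists_map_eq {l l' : List (SignedSet n)} (hlen : l.length = l'.length)
    (hl : (l.map idx).Nodup) (hl' : (l'.map idx).Nodup) : ∃ g : SignedPerm n, l.map g.1 = l' := by
  induction l generalizing l' with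
  | nil => exact ⟨1, by rw [List.length_nil] at hlen; rw [List.length_eq_zero_iff.1 hlen.symm]; rfl⟩
  | cons a l ih =>
    cases l' with
    | nil => simp at hlen
    | cons b l' =>
      rw [List.map_cons, List.nodup_cons] at hl hl'
      obtain ⟨g, rfl⟩ := ih (by simpa using hlen) hl.2 hl'.2
      -- By distinctness, the indices of `g.1 a` and `b` do not occur in the image of the tail, so
      -- the swap leaves it alone.
      refine ⟨swap (g.1 a) b * g, ?_⟩
      rw [List.map_cons]
      congr 1
      · exact swap_apply_left _ _
      · refine List.map_congr_left fun x hx => ?_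
        refine swap_apply_of_idx_ne (fun h => hl.1 ?_) fun h => hl'.1 ?_
        · rw [← (idx_apply_eq_iff g).1 h]
          exact List.mem_map_of_mem hx
        · rw [← h]
          exact List.mem_map_of_mem (List.mem_map_of_mem hx)

section Incl

variable {m : ℕ} (h : m ≤ n)

theorem incl_apply_incl (g : SignedPerm m) (y : SignedSet m) :
    (incl h g).1 (SignedSet.incl h y) = SignedSet.incl h (g.1 y) :=
  Equiv.Perm.viaEmbedding_apply _ _ _

theorem incl_apply_of_lt (g : SignedPerm m) {x : SignedSet n} (hx : m < x.1.natAbs) :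
    (incl h g).1 x = x :=
  Equiv.Perm.viaEmbedding_apply_of_notMem _ _ _ (by rw [mem_range_incl]; omega)

theorem incl_injective : Function.Injective (incl h) := fun _ _ hg =>
  Subtype.ext (Equiv.Perm.viaEmbeddingHom_injective _ (congrArg Subtype.val hg))

theorem incl_comp_incl {l : ℕ} (h' : l ≤ m) : (incl h).comp (incl h') = incl (h'.trans h) := by
  refine MonoidHom.ext fun g => ext_apply fun x => ?_
  change (incl h (incl h' g)).1 x = _
  by_cases hx : x.1.natAbs ≤ m
  · obtain ⟨y, rfl⟩ := (mem_range_incl h).2 hx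
    rw [incl_apply_incl]
    by_cases hy : y.1.natAbs ≤ l
    · obtain ⟨z, rfl⟩ := (mem_range_incl h').2 hy
      rw [incl_apply_incl]
      exact (incl_apply_incl (h'.trans h) g z).symm
    · rw [incl_apply_of_lt h' g (by omega), incl_apply_of_lt]
      exact not_le.1 hy
  · rw [incl_apply_of_lt h _ (by omega), incl_apply_of_lt _ _ (by omega)]

theorem commute_incl {g : SignedPerm n} (hg : ∀ x, x.1.natAbs ≤ m → g.1 x = x) (s : SignedPerm m) :
    g * incl h s = incl h s * g := by
  refine ext_apply fun x => ?_
  change g.1 ((incl h s).1 x) = (incl h s).1 (g.1 x)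
  by_cases hx : x.1.natAbs ≤ m
  · rw [hg x hx]
    obtain ⟨y, rfl⟩ := (mem_range_incl h).2 hx
    rw [incl_apply_incl]
    exact hg _ ((mem_range_incl h).1 ⟨_, rfl⟩)
  · rw [incl_apply_of_lt h s (by omega), incl_apply_of_lt h s]
    by_contra hgx
    have := g.1.injective (hg _ (not_lt.1 hgx))
    rw [this] at hgx
    omega

/-- A signed permutation fixing all letters of absolute value greater than `m` comes from
`SignedPerm m`. -/
theorem mem_range_incl {g : SignedPerm n} (hg : ∀ x, m < x.1.natAbs → g.1 x = x) :
    g ∈ (incl h).range := by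
  have hg' : ∀ x, m < x.1.natAbs → g⁻¹.1 x = x := fun x hx =>
    (Equiv.symm_apply_eq _).2 (hg x hx).symm
  have stable : ∀ g : SignedPerm n, (∀ x, m < x.1.natAbs → g.1 x = x) → ∀ y : SignedSet m,
      |(g.1 (SignedSet.incl h y)).1| ≤ (m : ℤ) := fun g hg y => by
    have hy := (SignedSet.mem_range_incl h).1 ⟨y, rfl⟩
    rw [abs_le_natCast_iff]
    by_contra hgy
    have := g.1.injective (hg (g.1 (SignedSet.incl h y)) (by omega))
    rw [this] at hgy
    omega
  let r (g : SignedPerm n) (hg : ∀ x, m < x.1.natAbs → g.1 x = x) (y : SignedSet m) : SignedSet m :=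
    ⟨(g.1 (SignedSet.incl h y)).1, (g.1 (SignedSet.incl h y)).2.1, stable g hg y⟩
  have hr : ∀ g hg y, SignedSet.incl h (r g hg y) = g.1 (SignedSet.incl h y) := fun _ _ _ => rfl
  let s : SignedPerm m :=
    ⟨⟨r g hg, r g⁻¹ hg', fun y => (SignedSet.incl h).injective ?_,
      fun y => (SignedSet.incl h).injective ?_⟩, fun y => (SignedSet.incl h).injective ?_⟩
  · refine ⟨s, ext_apply fun x => ?_⟩
    by_cases hx : x.1.natAbs ≤ m
    · obtain ⟨y, rfl⟩ := (SignedSet.mem_range_incl h).2 hx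
      rw [incl_apply_incl]
      exact hr g hg y
    · rw [incl_apply_of_lt h s (by omega), hg x (by omega)]
  · rw [hr g⁻¹ hg', hr g hg]
    exact g.1.symm_apply_apply _
  · rw [hr g hg, hr g⁻¹ hg']
    exact g.1.apply_symm_apply _
  · exact g.2 (SignedSet.incl h y)

end Incl

instance : Finite (SignedPerm n) := Subtype.finite

noncomputable instance : Fintype (SignedPerm n) := Fintype.ofFinite _

end SignedPerm

open SignedSet

/-- Words of length `k` in the letters `±1, …, ±n` with distinct absolute values. -/
def SignedWord (n k : ℕ) : Type :=
  {l : List (SignedSet n) // l.length = k ∧ (l.map idx).Nodup}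

namespace SignedWord

variable {n k : ℕ}

theorem ext {u v : SignedWord n k} (h : u.1 = v.1) : u = v := Subtype.ext h

theorem nodup_map_idx_map (g : SignedPerm n) {l : List (SignedSet n)} (hl : (l.map idx).Nodup) :
    ((l.map g.1).map idx).Nodup := by
  rw [List.Nodup, List.pairwise_map] at hl
  rw [List.Nodup, List.pairwise_map, List.pairwise_map]
  exact hl.imp fun h => fun h' => h ((SignedPerm.idx_apply_eq_iff g).1 h')

instance : MulAction (SignedPerm n) (SignedWord n k) where
  smul g w := ⟨w.1.map g.1, by rw [List.length_map, w.2.1], nodup_map_idx_map g w.2.2⟩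
  one_smul w := ext (List.map_id _)
  mul_smul g h w := ext (List.map_map (f := h.1) (g := g.1) (l := w.1)).symm

theorem smul_val (g : SignedPerm n) (w : SignedWord n k) : (g • w).1 = w.1.map g.1 := rfl

theorem exists_smul_eq (u v : SignedWord n k) : ∃ g : SignedPerm n, g • u = v := by
  obtain ⟨g, hg⟩ := SignedPerm.exists_map_eq (u.2.1.trans v.2.1.symm) u.2.2 v.2.2
  exact ⟨g, ext hg⟩

/-- Deleting the `i`-th letter. -/
def face (i : Fin (k + 1)) (w : SignedWord n (k + 1)) : SignedWord n k :=
  ⟨w.1.eraseIdx i, by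
    rw [List.length_eraseIdx_of_lt (by rw [w.2.1]; exact i.2), w.2.1]; rfl,
    w.2.2.sublist ((List.eraseIdx_sublist _ _).map _)⟩

theorem smul_face (g : SignedPerm n) (i : Fin (k + 1)) (w : SignedWord n (k + 1)) :
    g • face i w = face i (g • w) :=
  ext (List.eraseIdx_map ..).symm

/-- The word `n, n - 1, …, n - k + 1`. -/
def std (h : k ≤ n) : SignedWord n k :=
  ⟨List.ofFn fun i : Fin k => letter (i.2.trans_le h), List.length_ofFn, by
    rw [List.map_ofFn, List.nodup_ofFn]
    exact fun i j hij => Fin.ext (idx_letter_injective hij)⟩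

theorem std_getElem (h : k ≤ n) (i : ℕ) (hi : i < (std h).1.length) :
    (std h).1[i] = letter ((hi.trans_eq (std h).2.1).trans_le h) := by
  simp [std]

/-- Fixing a letter also fixes its negative, so the stabilizer of the standard word is the image of
`SignedPerm (n - k)`. -/
theorem smul_std_eq_iff (h : k ≤ n) (g : SignedPerm n) :
    g • std h = std h ↔ ∀ x, n - k < x.1.natAbs → g.1 x = x := by
  constructor
  · intro hg x hx
    have hxn := x.natAbs_le
    obtain ⟨hi, hxi⟩ := eq_letter_or x (n - x.1.natAbs) (by omega)
    have hlen : n - x.1.natAbs < (std h).1.length := by rw [(std h).2.1]; omega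
    have key : g.1 (letter hi) = letter hi := by
      have h₁ : (g • std h).1[n - x.1.natAbs]'(by rw [(g • std h).2.1]; omega) =
        (std h).1[n - x.1.natAbs] := by simp only [hg]
      simpa only [smul_val, List.getElem_map, std_getElem] using h₁
    rcases hxi with hxi | hxi
    · rw [hxi, key]
    · rw [hxi, SignedPerm.apply_neg, key]
  · intro hg
    refine ext ?_
    rw [smul_val]
    conv_rhs => rw [← List.map_id (std h).1]
    refine List.map_congr_left fun x hx => ?_
    obtain ⟨i, hi, rfl⟩ := List.getElem_of_mem hx
    rw [std_getElem]
    refine hg _ ?_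
    rw [(std h).2.1] at hi
    simp only [letter]
    omega

/-- The faces of the standard word are permuted by signed permutations fixing all letters outside
the word. -/
theorem exists_smul_std_eq_face (h : k + 1 ≤ n) (i : Fin (k + 1)) :
    ∃ g : SignedPerm n, (∀ x, x.1.natAbs ≤ n - (k + 1) → g.1 x = x) ∧
      g • std (k.le_succ.trans h) = face i (std h) := by
  have hstd := (std (le_refl n)).2
  -- Working with the full word of length `n` forces `g` to fix the tail: erasing position `k` or
  -- position `i ≤ k` leaves the same letters from position `k` on.
  obtain ⟨g, hg⟩ := SignedPerm.exists_map_eq (l := (std (le_refl n)).1.eraseIdx k)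
    (l' := (std (le_refl n)).1.eraseIdx i)
    (by rw [List.length_eraseIdx_of_lt (by omega), List.length_eraseIdx_of_lt (by omega)])
    (hstd.2.sublist ((List.eraseIdx_sublist _ _).map _))
    (hstd.2.sublist ((List.eraseIdx_sublist _ _).map _))
  have hg' (j : ℕ) (hj : j + 1 < n) :
      g.1 (if hjk : j < k then letter (n := n) (i := j) (by omega) else letter hj) =
        if hji : j < i then letter (n := n) (i := j) (by omega) else letter hj := by
    have h₁ : ((std (le_refl n)).1.eraseIdx k).length = n - 1 := by
      rw [List.length_eraseIdx_of_lt (by omega), hstd.1]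
    have h₂ : ((std (le_refl n)).1.eraseIdx i).length = n - 1 := by
      rw [List.length_eraseIdx_of_lt (by omega), hstd.1]
    have h₃ : (((std (le_refl n)).1.eraseIdx k).map g.1)[j]'(by rw [List.length_map]; omega) =
        ((std (le_refl n)).1.eraseIdx i)[j]'(by omega) := by simp only [hg]
    simpa only [List.getElem_map, List.getElem_eraseIdx, std_getElem] using h₃
  refine ⟨g, fun x hx => ?_, ext (List.ext_getElem ?_ fun j h₁ h₂ => ?_)⟩
  · have := x.2.1
    obtain ⟨hj, hxj⟩ := eq_letter_or x (n - 1 - x.1.natAbs + 1) (by omega)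
    have key := hg' (n - 1 - x.1.natAbs) hj
    rw [dif_neg (by omega), dif_neg (by omega)] at key
    rcases hxj with hxj | hxj
    · rw [hxj, key]
    · rw [hxj, SignedPerm.apply_neg, key]
  · rw [(g • std _).2.1, (face i (std h)).2.1]
  · have hjk : j < k := by rwa [(g • std _).2.1] at h₁
    have key := hg' j (by omega)
    rw [dif_pos hjk] at key
    simpa only [smul_val, face, List.getElem_map, List.getElem_eraseIdx, std_getElem] using key

end SignedWord

end SignedWords

/-! ### The differentials on homology and the stabilization maps. -/

section Stabilization

open CategoryTheory

namespace groupHomology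

open Rep

universe u

variable {k G : Type u} [CommRing k] [Group G]

/-- Needed to evaluate homology on the alternating sum of faces. -/
instance functor_additive (n : ℕ) : (functor k G n).Additive where
  map_add {A B φ ψ} := by
    have h : chainsMap (MonoidHom.id G) (φ + ψ) =
        chainsMap (MonoidHom.id G) φ + chainsMap (MonoidHom.id G) ψ := by
      refine HomologicalComplex.hom_ext _ _ fun i => ModuleCat.hom_ext (Finsupp.lhom_ext fun g a => ?_)
      change (chainsMap (MonoidHom.id G) (φ + ψ)).f i (Finsupp.single g a) =
        (chainsMap (MonoidHom.id G) φ).f i (Finsupp.single g a) +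
          (chainsMap (MonoidHom.id G) ψ).f i (Finsupp.single g a)
      rw [chainsMap_f_single, chainsMap_f_single, chainsMap_f_single, ← Finsupp.single_add]
      rfl
    change HomologicalComplex.homologyMap (chainsMap (MonoidHom.id G) (φ + ψ)) n = _
    rw [h, HomologicalComplex.homologyMap_add]
    rfl

theorem map_comp_eq {H K : Type u} [Group H] [Group K] {A : Rep.{u} k G} {B : Rep.{u} k H}
    {C : Rep.{u} k K} {f : G →* H} {g : H →* K} {e : G →* K} {φ : A ⟶ res f B} {ψ : B ⟶ res g C}
    {χ : A ⟶ res e C} (he : g.comp f = e) (h : ∀ x, ψ.hom (φ.hom x) = χ.hom x) (n : ℕ) :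
    map f φ n ≫ map g ψ n = map e χ n := by
  rw [← map_comp]
  exact map_congr he (LinearMap.ext h) n

end groupHomology

namespace SignedWord

open Rep Finsupp groupHomology

variable {n k : ℕ}

/-- The permutation representation of `SignedPerm n` on signed words of length `k`. -/
noncomputable abbrev rep (n k : ℕ) : Rep ℤ (SignedPerm n) :=
  permTensor (SignedWord n k) (Rep.trivial ℤ (SignedPerm n) ℤ)

/-- The morphism deleting the `i`-th letter. -/
noncomputable def faceHom (n : ℕ) {k : ℕ} (i : Fin (k + 1)) : rep n (k + 1) ⟶ rep n k :=
  Rep.ofHom ⟨lmapDomain ℤ ℤ (face i), fun g => lhom_ext fun w c => by simp [smul_face]⟩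

theorem faceHom_single (i : Fin (k + 1)) (w : SignedWord n (k + 1)) (c : ℤ) :
    (faceHom n i).hom (single w c) = single (face i w) c :=
  mapDomain_single

/-- The boundary morphism on signed words. -/
noncomputable def d (n k : ℕ) : rep n (k + 1) ⟶ rep n k :=
  ∑ i : Fin (k + 1), (-1 : ℤ) ^ (i : ℕ) • faceHom n i

theorem d_single (w : SignedWord n (k + 1)) (c : ℤ) :
    (d n k).hom (single w c) = ∑ i : Fin (k + 1), (-1 : ℤ) ^ (i : ℕ) • single (face i w) c := by
  rw [d, Rep.sum_hom, Representation.IntertwiningMap.sum_apply]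
  refine Finset.sum_congr rfl fun i _ => ?_
  rw [← faceHom_single]
  rfl

/-- The linear map sending a signed word to the underlying list. -/
noncomputable def toWords : (SignedWord n k →₀ ℤ) →ₗ[ℤ] (List (SignedSet n) →₀ ℤ) :=
  lmapDomain ℤ ℤ fun w : SignedWord n k => w.1

theorem toWords_single (w : SignedWord n k) (c : ℤ) : toWords (single w c) = single w.1 c :=
  mapDomain_single

theorem toWords_injective : Function.Injective (toWords (n := n) (k := k)) :=
  mapDomain_injective Subtype.val_injective

theorem range_toWords : LinearMap.range (toWords (n := n) (k := k)) =
    supported ℤ ℤ (WordComplex.words SignedSet.idx Finset.univ k) := by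
  rw [toWords, LinearMap.range_eq_map, ← supported_univ, lmapDomain_supported, Set.image_univ]
  congr 1
  ext l
  constructor
  · rintro ⟨w, rfl⟩
    exact ⟨w.2.1, w.2.2, fun x _ => Finset.mem_univ _⟩
  · rintro ⟨h₁, h₂, -⟩
    exact ⟨⟨l, h₁, h₂⟩, rfl⟩

theorem bd_eq_sum {E : Type*} (l : List E) :
    WordComplex.bd l = ∑ i ∈ Finset.range l.length, (-1 : ℤ) ^ i • single (l.eraseIdx i) (1 : ℤ) := by
  induction l with
  | nil => simp [WordComplex.bd]
  | cons x l ih =>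
    rw [WordComplex.bd, ih, List.length_cons, Finset.sum_range_succ', map_sum, sub_eq_add_neg,
      ← Finset.sum_neg_distrib, add_comm]
    simp [pow_succ]

theorem toWords_d (z : rep n (k + 1)) :
    toWords ((d n k).hom z) = WordComplex.boundary (toWords z) := by
  induction z using Finsupp.induction_linear with
  | zero => simp
  | add _ _ h₁ h₂ => rw [map_add, map_add, map_add, map_add, h₁, h₂]
  | single w c =>
    rw [d_single, toWords_single, WordComplex.boundary_single, bd_eq_sum, w.2.1,
      Finset.sum_range, map_sum, Finset.smul_sum]
    refine Finset.sum_congr rfl fun i _ => ?_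
    rw [map_smul, toWords_single, smul_comm, smul_single_one]
    rfl

theorem d_comp_d (n k : ℕ) : d n (k + 1) ≫ d n k = 0 := by
  refine Rep.hom_ext (DFunLike.ext _ _ fun z => toWords_injective ?_)
  change toWords ((d n k).hom ((d n (k + 1)).hom z)) = toWords 0
  rw [toWords_d, toWords_d, WordComplex.boundary_boundary, map_zero]

theorem exists_d_eq (hk : k < n) (z : rep n k) (hz : WordComplex.boundary (toWords z) = 0) :
    ∃ y, (d n k).hom y = z := by
  obtain ⟨y, hy, hyz⟩ := WordComplex.acyclic SignedSet.idx SignedSet.idx_surjective Finset.univ k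
    (by simpa using hk) (toWords z) (range_toWords.le ⟨z, rfl⟩) hz
  obtain ⟨y, rfl⟩ := range_toWords.ge hy
  exact ⟨y, toWords_injective ((toWords_d y).trans hyz)⟩

theorem epi_toSeqCycles (hk : k < n) : Epi (toSeqCycles (d n) (d_comp_d n) k) := by
  cases k with
  | zero =>
    refine (Rep.epi_iff_surjective _).2 fun z => exists_d_eq hk z ?_
    induction z using Finsupp.induction_linear with
    | zero => simp
    | add _ _ h₁ h₂ => rw [map_add, map_add, h₁, h₂, add_zero]
    | single w c =>
      rw [toWords_single, List.length_eq_zero_iff.1 w.2.1, WordComplex.boundary_single]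
      simp [WordComplex.bd]
  | succ k =>
    have : (ShortComplex.mk (d n (k + 1)) (d n k) (d_comp_d n k)).Exact := by
      rw [Rep.exact_iff]
      refine fun z => ⟨fun hz => ?_, ?_⟩
      · refine exists_d_eq hk z ?_
        rw [← toWords_d]
        exact (congrArg toWords hz).trans (map_zero _)
      · rintro ⟨y, rfl⟩
        exact congrArg (fun φ : rep n (k + 2) ⟶ rep n k => φ.hom y) (d_comp_d n k)
    exact this.epi_kernelLift

section Stabilization

variable {S T : Type} [Group S] [Group T]

/-- The morphism `ℤ ⟶ ℤ[words]` given by a fixed word. -/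
noncomputable abbrev singleHom (f : S →* SignedPerm n) (w : SignedWord n k)
    (hw : ∀ s, f s • w = w) : Rep.trivial ℤ S ℤ ⟶ res f (rep n k) :=
  Rep.ofHom ⟨lsingle w, fun s => LinearMap.ext_ring (by simp [hw])⟩

theorem map_singleHom_faceHom (f : S →* SignedPerm n) (w : SignedWord n (k + 1))
    (hw : ∀ s, f s • w = w) (i : Fin (k + 1)) (q : ℕ) :
    map f (singleHom f w hw) q ≫ (functor ℤ (SignedPerm n) q).map (faceHom n i) =
      map f (singleHom f (face i w) fun s => by rw [smul_face, hw]) q := by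
  refine map_comp_eq (MonoidHom.id_comp f) (fun c => ?_) q
  exact faceHom_single i w c

/-- Conjugation by `g` is the identity on the image of `f` and carries `w` to `w'`, while it acts
trivially on the homology of `SignedPerm n`. -/
theorem map_singleHom_smul (f : S →* SignedPerm n) (w w' : SignedWord n k)
    (hw : ∀ s, f s • w = w) (hw' : ∀ s, f s • w' = w') (g : SignedPerm n) (hg : g • w = w')
    (hgf : ∀ s, g * f s = f s * g) (q : ℕ) :
    map f (singleHom f w' hw') q = map f (singleHom f w hw) q := by
  let ψ : rep n k ⟶ res (MulAut.conj g).toMonoidHom (rep n k) :=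
    Rep.ofHom ⟨(rep n k).ρ g, fun h => by
      change (rep n k).ρ g * (rep n k).ρ h = (rep n k).ρ (g * h * g⁻¹) * (rep n k).ρ g
      rw [← map_mul, ← map_mul, inv_mul_cancel_right]⟩
  have h := map_conj_eq_id g q (rep n k) ψ fun _ => rfl
  rw [← Category.comp_id (map f (singleHom f w hw) q), ← h]
  refine (map_comp_eq (MonoidHom.ext fun s => ?_) (fun c => ?_) q).symm
  · change g * f s * g⁻¹ = f s
    rw [hgf, mul_inv_cancel_right]
  · change (rep n k).ρ g (single w c) = single w' c
    rw [permTensor_ρ_single, hg]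
    rfl

theorem map_singleHom_congr {f f' : S →* SignedPerm n} (h : f = f') (w : SignedWord n k)
    (hw : ∀ s, f s • w = w) (hw' : ∀ s, f' s • w = w) (q : ℕ) :
    map f (singleHom f w hw) q = map f' (singleHom f' w hw') q := by
  subst h
  rfl

theorem map_singleHom_comp (e : T →* S) (f : S →* SignedPerm n) (w : SignedWord n k)
    (hw : ∀ s, f s • w = w) (q : ℕ) :
    map (f.comp e) (singleHom (f.comp e) w fun t => hw (e t)) q =
      integralHomologyMap e q ≫ map f (singleHom f w hw) q :=
  (map_comp_eq rfl (fun _ => rfl) q).symm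

end Stabilization

theorem incl_smul_std (hk : k ≤ n) (s : SignedPerm (n - k)) :
    SignedPerm.incl (Nat.sub_le n k) s • std hk = std hk :=
  (smul_std_eq_iff hk _).2 fun _ hx => SignedPerm.incl_apply_of_lt _ s hx

/-- The Shapiro map `H_q(SignedPerm (n - k)) ⟶ H_q(SignedPerm n; ℤ[words of length k])`. -/
noncomputable def shapiro (hk : k ≤ n) (q : ℕ) :
    integralHomology (SignedPerm (n - k)) q ⟶ (functor ℤ (SignedPerm n) q).obj (rep n k) :=
  map (SignedPerm.incl (Nat.sub_le n k)) (singleHom _ (std hk) (incl_smul_std hk)) q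

instance isIso_shapiro (hk : k ≤ n) (q : ℕ) : IsIso (shapiro hk q) :=
  isIso_map_permTensorSingle (SignedPerm.incl (Nat.sub_le n k)) (std hk)
    (SignedPerm.incl_injective _) (incl_smul_std hk)
    (fun g hg => SignedPerm.mem_range_incl _ ((smul_std_eq_iff hk g).1 hg))
    (fun v => exists_smul_eq (std hk) v) q (Rep.trivial ℤ (SignedPerm n) ℤ)

/-- Each face of the standard word is a translate of the shorter standard word by an element
commuting with `SignedPerm (n - (k + 1))`, so all faces contribute the same map and only the sum of
signs remains. -/
theorem shapiro_comp_d (hk : k + 1 ≤ n) (q : ℕ) :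
    shapiro hk q ≫ (functor ℤ (SignedPerm n) q).map (d n k) =
      (∑ i : Fin (k + 1), (-1 : ℤ) ^ (i : ℕ)) •
        (integralHomologyMap (SignedPerm.incl (Nat.sub_le (n - k) 1)) q ≫
          shapiro (k.le_succ.trans hk) q) := by
  have hface (i : Fin (k + 1)) : shapiro hk q ≫ (functor ℤ (SignedPerm n) q).map (faceHom n i) =
      integralHomologyMap (SignedPerm.incl (Nat.sub_le (n - k) 1)) q ≫
          shapiro (k.le_succ.trans hk) q := by
    obtain ⟨g, hg, hgw⟩ := exists_smul_std_eq_face hk i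
    have hfix (s : SignedPerm (n - (k + 1))) : SignedPerm.incl (Nat.sub_le n (k + 1)) s •
        std (k.le_succ.trans hk) = std (k.le_succ.trans hk) :=
      (smul_std_eq_iff _ _).2 fun _ hx => SignedPerm.incl_apply_of_lt _ s (by omega)
    refine (map_singleHom_faceHom _ _ _ i q).trans (Eq.trans ?_ (map_singleHom_comp
      (SignedPerm.incl (Nat.sub_le (n - k) 1)) (SignedPerm.incl (Nat.sub_le n k))
      (std (k.le_succ.trans hk)) (incl_smul_std _) q))
    refine (map_singleHom_smul (SignedPerm.incl (Nat.sub_le n (k + 1))) _ _ hfix _ g hgw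
      (SignedPerm.commute_incl _ hg) q).trans ?_
    exact map_singleHom_congr (SignedPerm.incl_comp_incl (Nat.sub_le n k)
      (Nat.sub_le (n - k) 1)).symm _ _ _ q
  rw [d, Functor.map_sum, Preadditive.comp_sum, Finset.sum_smul]
  refine Finset.sum_congr rfl fun i _ => ?_
  rw [Functor.map_zsmul, Preadditive.comp_zsmul, hface]

theorem map_d_eq_zero (hk : k + 1 ≤ n) (hodd : Odd k) (q : ℕ) :
    (functor ℤ (SignedPerm n) q).map (d n k) = 0 := by
  have h := shapiro_comp_d hk q
  rw [Fin.sum_univ_eq_sum_range (fun i => (-1 : ℤ) ^ i), neg_one_geom_sum,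
    if_pos (by grind), zero_smul] at h
  rw [← cancel_epi (shapiro hk q), h, Limits.comp_zero]

theorem shapiro_comp_d_of_even (hk : k + 1 ≤ n) (heven : Even k) (q : ℕ) :
    shapiro hk q ≫ (functor ℤ (SignedPerm n) q).map (d n k) =
      integralHomologyMap (SignedPerm.incl (Nat.sub_le (n - k) 1)) q ≫
        shapiro (k.le_succ.trans hk) q := by
  rw [shapiro_comp_d, Fin.sum_univ_eq_sum_range (fun i => (-1 : ℤ) ^ i), neg_one_geom_sum,
    if_neg (by grind), one_smul]

theorem isIso_map_d_iff (hk : k + 1 ≤ n) (heven : Even k) (q : ℕ) :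
    IsIso ((functor ℤ (SignedPerm n) q).map (d n k)) ↔
      IsIso (integralHomologyMap (SignedPerm.incl (Nat.sub_le (n - k) 1)) q) := by
  have h := shapiro_comp_d_of_even hk heven q
  constructor
  · intro hd
    have : IsIso (integralHomologyMap (SignedPerm.incl (Nat.sub_le (n - k) 1)) q ≫
        shapiro (k.le_succ.trans hk) q) := by
      rw [← h]; exact IsIso.comp_isIso
    exact IsIso.of_isIso_comp_right _ (shapiro (k.le_succ.trans hk) q)
  · intro hs
    have : IsIso (shapiro hk q ≫ (functor ℤ (SignedPerm n) q).map (d n k)) := by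
      rw [h]; exact IsIso.comp_isIso' hs (isIso_shapiro _ q)
    exact IsIso.of_isIso_comp_left (shapiro hk q) _

end SignedWord

theorem isIso_integralHomologyMap_zero {G H : Type} [Group G] [Group H] (f : G →* H) :
    IsIso (integralHomologyMap f 0) := by
  have hG : IsIso (groupHomology.H0π (Rep.trivial ℤ G ℤ)) := by
    rw [← groupHomology.H0IsoOfIsTrivial_inv_eq_π]; infer_instance
  have hH : IsIso (groupHomology.H0π (Rep.trivial ℤ H ℤ)) := by
    rw [← groupHomology.H0IsoOfIsTrivial_inv_eq_π]; infer_instance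
  have h : groupHomology.H0π (Rep.trivial ℤ G ℤ) ≫ integralHomologyMap f 0 =
      groupHomology.H0π (Rep.trivial ℤ H ℤ) :=
    (groupHomology.H0π_comp_map (A := Rep.trivial ℤ G ℤ) (B := Rep.trivial ℤ H ℤ) f
      (𝟙 (Rep.trivial ℤ G ℤ))).trans (Category.id_comp _)
  have : IsIso (groupHomology.H0π (Rep.trivial ℤ G ℤ) ≫ integralHomologyMap f 0) := by
    rw [h]; exact hH
  exact IsIso.of_isIso_comp_left (groupHomology.H0π (Rep.trivial ℤ G ℤ)) _

end Stabilization

theorem proposition6 (n r : ℕ) (h : 2 * r < n) :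
    CategoryTheory.IsIso
      (integralHomologyMap
        (SignedPerm.incl (Nat.sub_le n 1) : SignedPerm (n - 1) →* SignedPerm n) r) := by
  induction r using Nat.strong_induction_on generalizing n with
  | _ r ih =>
    rcases Nat.eq_zero_or_pos r with rfl | hr
    · exact isIso_integralHomologyMap_zero _
    -- At `k = 0` the differential induces exactly the stabilization map in question.
    · refine (SignedWord.isIso_map_d_iff (k := 0) (by omega) (by simp) r).1 ?_
      refine groupHomology.isIso_map_d_zero (SignedWord.d n) (SignedWord.d_comp_d n)
        (fun i hi => SignedWord.epi_toSeqCycles hi) (fun i q hq hi hiq => ?_) (by omega) h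
        (SignedWord.map_d_eq_zero (by omega) (by simp) r)
      -- The range `i + 2 * q < n` is the stable range `2 * q < n - i` for `SignedPerm (n - i)`.
      exact (SignedWord.isIso_map_d_iff (by omega) hi q).2 (ih q hq (n - i) (by omega))
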